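/- Let $\Omega=(-\pi,\pi)\times(0,\pi)$, and let all functions be real-valued. Write $\|\cdot\|_2$ and $\langle\cdot,\cdot\rangle_2$ for the norm and the scalar product of $L_2(\Omega)$, and $H^k(\Omega)$ for the usual $L_2$-based Sobolev space. Let $C^\infty_{\mathrm{div}}(\overline\Omega)$ be the set of all $u\in C^\infty(\overline\Omega)$ such that $\partial^\gamma u(-\pi,x_2)=\partial^\gamma u(\pi,x_2)$ for all $x_2\in[0,\pi]$ and $\gamma\in\mathbb N_0^2$, $u(\cdot,0)=u(\cdot,\pi)=0$, and $\int_0^\pi\partial_1u(\cdot,x_2)\,dx_2=0$. For $k\in\{1,2\}$ let $H^k_{\mathrm{div}}(\Omega)$ be the closure of $C^\infty_{\mathrm{div}}(\overline\Omega)$ in $H^k(\Omega)$. For $u,v\in H^1(\Omega)$ put \[ B(u,v):=u\,\partial_1v+v_u\,\partial_2v,\qquad v_u(x_1,x_2):=-\int_0^{x_2}\partial_1u(x_1,s)\,ds . \] (a) There is a constant $M_B\ge0$ such that for all $u,v,w\in H^1_{\mathrm{div}}(\Omega)$ the function $B(u,v)w$ is integrable and \[ \int_\Omega|B(u,v)w|\,dx\le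 M_B\,\|\nabla u\|_2\,\|\nabla v\|_2\,\|\nabla w\|_2 . \] (b) There are constants $M_B',M_B''\ge0$ such that for all $u,v\in H^2_{\mathrm{div}}(\Omega)$ and $w\in L_2(\Omega)$ the function $B(u,v)w$ is integrable and \begin{align*} \int_\Omega|B(u,v)w|\,dx &\le M_B'\Bigl(\|u\|_2^{1/2}\|\nabla u\|_2^{1/2}\|\partial_1v\|_2^{1/2}\|\partial_1\nabla v\|_2^{1/2} +\|\partial_1u\|_2\|\partial_2v\|_2^{1/2}\bigl(\|\partial_2v\|_2^{1/2}+\|\partial_1\nabla v\|_2^{1/2}\bigr)\Bigr)\|w\|_2\\ &\le M_B''\,\|\nabla u\|_2\|\nabla v\|_2^{1/2}\|\Delta v\|_2^{1/2}\|w\|_2 \le M_B''\,\|\nabla u\|_2\|\Delta v\|_2\|w\|_2 . \end{align*} (c) For all $u,v\in H^1_{\mathrm{div}}(\Omega)$, the function $B(u,v)v$ is integrable and $\int_\Omega B(u,v)v\,dx=0$. Moreover, if $u\in H^2_{\mathrm{div}}(\Omega)$, then $B(u,u)\in L_2(\Omega)$ and $\langle B(u,u),\partial_2^2u\rangle_2=0$.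 -/

import Mathlib

open MeasureTheory Set
open scoped ContDiff

namespace HydroFlow

noncomputable section

/-- The rectangle `Ω = (-π, π) × (0, π)`. -/
def Ω : Set (ℝ × ℝ) := Ioo (-Real.pi) Real.pi ×ˢ Ioo 0 Real.pi

/-- Lebesgue measure on `Ω`. -/
abbrev μΩ : Measure (ℝ × ℝ) := volume.restrict Ω

/-- The real Hilbert space `L₂(Ω)`; its norm is `‖·‖₂`. -/
abbrev L2 : Type := Lp (α := ℝ × ℝ) ℝ 2 μΩ

/-- The classical partial derivative `∂₁ f`. -/
def pd1 (f : ℝ × ℝ → ℝ) : ℝ × ℝ → ℝ := fun x => fderiv ℝ f x (1, 0)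

/-- The classical partial derivative `∂₂ f`. -/
def pd2 (f : ℝ × ℝ → ℝ) : ℝ × ℝ → ℝ := fun x => fderiv ℝ f x (0, 1)

/-- The classical partial derivative `∂^γ f = ∂₁^a ∂₂^b f` for `γ = (a, b)`. -/
def pd (a b : ℕ) (f : ℝ × ℝ → ℝ) : ℝ × ℝ → ℝ := pd1^[a] (pd2^[b] f)

/-- `φ ∈ C_c^∞(Ω)`. -/
structure IsTest (φ : ℝ × ℝ → ℝ) : Prop where
  contDiff : ContDiff ℝ ∞ φ
  hasCompactSupport : HasCompactSupport φ
  tsupport_subset : tsupport φ ⊆ Ω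

/-- `g ∈ L₂(Ω)` is the weak derivative `∂^(a,b) u` of `u ∈ L₂(Ω)`. -/
def IsWeakDeriv (a b : ℕ) (u g : L2) : Prop :=
  ∀ φ : ℝ × ℝ → ℝ, IsTest φ →
    ∫ x, u x * pd a b φ x ∂μΩ = (-1) ^ (a + b) * ∫ x, g x * φ x ∂μΩ

open Classical in
/-- The weak derivative `∂^(a,b) u ∈ L₂(Ω)` of `u ∈ L₂(Ω)`
(with the value `0` if there is none in `L₂(Ω)`). -/
def wd (a b : ℕ) (u : L2) : L2 :=
  if h : ∃ g : L2, IsWeakDeriv a b u g then h.choose else 0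

/-- `‖∇u‖₂`. -/
def gradNorm (u : L2) : ℝ := √(‖wd 1 0 u‖ ^ 2 + ‖wd 0 1 u‖ ^ 2)

/-- `‖∂₁∇u‖₂`. -/
def d1GradNorm (u : L2) : ℝ := √(‖wd 2 0 u‖ ^ 2 + ‖wd 1 1 u‖ ^ 2)

/-- `Δu = ∂₁²u + ∂₂²u`. -/
def lap (u : L2) : L2 := wd 2 0 u + wd 0 2 u

/-- The Sobolev space `H^k(Ω)`: all weak derivatives of order at most `k` exist in `L₂(Ω)`. -/
def Hk (k : ℕ) : Set L2 :=
  {u | ∀ a b : ℕ, a + b ≤ k → ∃ g : L2, IsWeakDeriv a b u g}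

/-- The norm of `H^k(Ω)`; the sum runs over all `(a, b)` with `a + b ≤ k`. -/
def hkNorm (k : ℕ) (u : L2) : ℝ :=
  √(∑ a ∈ Finset.range (k + 1), ∑ b ∈ Finset.range (k + 1 - a), ‖wd a b u‖ ^ 2)

/-- The functions of `C_hp^∞(Ω̄)`, each given by a smooth extension to the plane: all derivatives
agree on the two vertical sides of the rectangle. -/
structure IsSmoothHP (φ : ℝ × ℝ → ℝ) : Prop where
  contDiff : ContDiff ℝ ∞ φ
  periodic : ∀ a b : ℕ, ∀ x₂ ∈ Icc 0 Real.pi,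
    pd a b φ (-Real.pi, x₂) = pd a b φ (Real.pi, x₂)

/-- The functions of `C_div^∞(Ω̄)`, each given by a smooth extension to the plane. -/
structure IsSmoothDiv (φ : ℝ × ℝ → ℝ) : Prop extends IsSmoothHP φ where
  bottom : ∀ x₁ ∈ Icc (-Real.pi) Real.pi, φ (x₁, 0) = 0
  top : ∀ x₁ ∈ Icc (-Real.pi) Real.pi, φ (x₁, Real.pi) = 0
  integral_eq_zero : ∀ x₁ ∈ Icc (-Real.pi) Real.pi,
    ∫ x₂ in (0 : ℝ)..Real.pi, pd1 φ (x₁, x₂) = 0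

/-- `C_div^∞(Ω̄)` as a subset of `L₂(Ω)`. -/
def CDiv : Set L2 := {f | ∃ φ : ℝ × ℝ → ℝ, IsSmoothDiv φ ∧ f =ᵐ[μΩ] φ}

/-- `H_div^k(Ω)`: the closure of `C_div^∞(Ω̄)` in `H^k(Ω)`. -/
def HDiv (k : ℕ) : Set L2 :=
  {u | u ∈ Hk k ∧ ∀ ε > 0, ∃ f ∈ CDiv, hkNorm k (u - f) < ε}

/-- `v_u(x₁, x₂) = -∫₀^{x₂} ∂₁u(x₁, s) ds`. -/
def vel (u : L2) : ℝ × ℝ → ℝ := fun x => -∫ s in (0 : ℝ)..x.2, wd 1 0 u (x.1, s)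

/-- The nonlinearity `B(u, v) = u ∂₁v + v_u ∂₂v`. -/
def B (u v : L2) : ℝ × ℝ → ℝ := fun x => u x * wd 1 0 v x + vel u x * wd 0 1 v x

end

end HydroFlow

/-! Everything is proved for smooth functions and carried to the closures by approximation. The
difficulty is `v_u`, which costs a horizontal derivative of `u`. It is met by an anisotropic product
estimate: `‖fg‖₂²` is at most `∫ sup_y f(x, y)² dx` times `sup_x ∫ g(x, y)² dy` (`nrm_mul_sq_le`).
The first factor is controlled if `f` vanishes at the bottom, or if `f = v_u`, where Cauchy–Schwarz
on vertical lines needs only `‖∂₁u‖₂`. The second is at most `2‖g‖₂(‖g‖₂ + ‖∂₁g‖₂)`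
(`integral_sq_snd_le`). For (a), `uw` is paired with `∂₁v` and `v_u w` with `∂₂v`; for (b), the
estimate is applied to `∂₁v · u` and `v_u ∂₂v`. The inequalities `‖u‖₂ ≤ ‖∇u‖₂ ≤ ‖Δu‖₂` and `‖∂₁∇u‖₂
≤ ‖Δu‖₂` give the rest of (b).

The cancellations in (c) hold because `∂₁u + ∂₂v_u = 0`: both `2B(u, v)v` and `2B(u, u)∂₂²u` are
sums of derivatives of products whose boundary terms vanish by periodicity, the zero boundary values
of `u`, or the vanishing of `v_u` at bottom and top.

For the limit, approximating sequences are chosen that also converge almost everywhere, including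
their vertical velocities (`exists_approximates`). The multilinear estimates, applied to
differences, make the nonlinear terms Cauchy in `L₁` or `L₂`, and Fatou's lemma identifies the limit
with the pointwise expression `B`. -/

namespace HydroFlow

open Filter Topology

/-! ### Classical partial derivatives -/

variable {f g : ℝ × ℝ → ℝ}

lemma contDiff_pd1 (hf : ContDiff ℝ ∞ f) : ContDiff ℝ ∞ (pd1 f) :=
  (hf.fderiv_right (m := ∞) (by simp)).clm_apply contDiff_const

lemma contDiff_pd2 (hf : ContDiff ℝ ∞ f) : ContDiff ℝ ∞ (pd2 f) :=
  (hf.fderiv_right (m := ∞) (by simp)).clm_apply contDiff_const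

lemma contDiff_pd (a b : ℕ) (hf : ContDiff ℝ ∞ f) : ContDiff ℝ ∞ (pd a b f) := by
  have h2 : ContDiff ℝ ∞ (pd2^[b] f) := by
    induction b with
    | zero => exact hf
    | succ n ih => rw [Function.iterate_succ_apply']; exact contDiff_pd2 ih
  unfold pd
  induction a with
  | zero => exact h2
  | succ n ih => rw [Function.iterate_succ_apply']; exact contDiff_pd1 ih

lemma pd_succ_left (a b : ℕ) (f : ℝ × ℝ → ℝ) : pd (a + 1) b f = pd1 (pd a b f) :=
  Function.iterate_succ_apply' _ _ _

lemma pd_zero_succ (b : ℕ) (f : ℝ × ℝ → ℝ) : pd 0 (b + 1) f = pd2 (pd 0 b f) :=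
  Function.iterate_succ_apply' _ _ _

lemma pd1_sub (hf : ContDiff ℝ ∞ f) (hg : ContDiff ℝ ∞ g) :
    pd1 (f - g) = pd1 f - pd1 g := by
  funext x
  simp [pd1, fderiv_sub (hf.differentiable (by simp) x) (hg.differentiable (by simp) x)]

lemma pd2_sub (hf : ContDiff ℝ ∞ f) (hg : ContDiff ℝ ∞ g) :
    pd2 (f - g) = pd2 f - pd2 g := by
  funext x
  simp [pd2, fderiv_sub (hf.differentiable (by simp) x) (hg.differentiable (by simp) x)]

lemma pd_sub (a b : ℕ) (hf : ContDiff ℝ ∞ f) (hg : ContDiff ℝ ∞ g) :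
    pd a b (f - g) = pd a b f - pd a b g := by
  induction a with
  | zero =>
    induction b with
    | zero => rfl
    | succ n ih =>
      rw [pd_zero_succ, ih, pd2_sub (contDiff_pd 0 n hf) (contDiff_pd 0 n hg), ← pd_zero_succ,
        ← pd_zero_succ]
  | succ n ih =>
    rw [pd_succ_left, ih, pd1_sub (contDiff_pd n b hf) (contDiff_pd n b hg), ← pd_succ_left,
      ← pd_succ_left]

lemma pd1_pd2_comm (hf : ContDiff ℝ ∞ f) : pd1 (pd2 f) = pd2 (pd1 f) := by
  funext x
  have hd : DifferentiableAt ℝ (fderiv ℝ f) x :=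
    (hf.fderiv_right (m := ∞) (by simp)).differentiable (by simp) x
  have hs : IsSymmSndFDerivAt ℝ f x := by
    refine ContDiffAt.isSymmSndFDerivAt (n := 2) (contDiff_infty.1 hf 2).contDiffAt ?_
    simp
  have h : ∀ v w : ℝ × ℝ, fderiv ℝ (fun y => fderiv ℝ f y v) x w = fderiv ℝ (fderiv ℝ f) x w v := by
    intro v w
    rw [fderiv_clm_apply hd (differentiableAt_const v)]
    simp
  have h1 : pd1 (pd2 f) x = fderiv ℝ (fun y => fderiv ℝ f y (0, 1)) x (1, 0) := rfl
  have h2 : pd2 (pd1 f) x = fderiv ℝ (fun y => fderiv ℝ f y (1, 0)) x (0, 1) := rfl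
  rw [h1, h2, h, h]
  exact hs _ _

lemma hasDerivAt_fst (hf : ContDiff ℝ ∞ f) (x y : ℝ) :
    HasDerivAt (fun t => f (t, y)) (pd1 f (x, y)) x := by
  have h := (hf.differentiable (by simp) (x, y)).hasFDerivAt
  have hc : HasDerivAt (fun t : ℝ => (t, y)) ((1 : ℝ), (0 : ℝ)) x :=
    (hasDerivAt_id x).prodMk (hasDerivAt_const x y)
  exact h.comp_hasDerivAt x hc

lemma hasDerivAt_snd (hf : ContDiff ℝ ∞ f) (x y : ℝ) :
    HasDerivAt (fun t => f (x, t)) (pd2 f (x, y)) y := by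
  have h := (hf.differentiable (by simp) (x, y)).hasFDerivAt
  have hc : HasDerivAt (fun t : ℝ => (x, t)) ((0 : ℝ), (1 : ℝ)) y :=
    (hasDerivAt_const y x).prodMk (hasDerivAt_id y)
  exact h.comp_hasDerivAt y hc

/-! ### Integration over the rectangle -/

lemma isOpen_Ω : IsOpen Ω := isOpen_Ioo.prod isOpen_Ioo

lemma measurableSet_Ω : MeasurableSet Ω := isOpen_Ω.measurableSet

lemma Ω_subset_Icc : Ω ⊆ Icc (-Real.pi) Real.pi ×ˢ Icc 0 Real.pi :=
  prod_mono Ioo_subset_Icc_self Ioo_subset_Icc_self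

lemma isCompact_closedRect : IsCompact (Icc (-Real.pi) Real.pi ×ˢ Icc 0 Real.pi) :=
  isCompact_Icc.prod isCompact_Icc

lemma μΩ_eq_prod : μΩ = (volume.restrict (Ioo (-Real.pi) Real.pi)).prod
    (volume.restrict (Ioo 0 Real.pi)) := by
  rw [Measure.prod_restrict]; rfl

instance : IsFiniteMeasure μΩ := by
  rw [μΩ_eq_prod]; infer_instance

lemma ae_mem_Ω : ∀ᵐ x ∂μΩ, x ∈ Ω := ae_restrict_mem measurableSet_Ω

lemma memLp_of_continuous (hf : Continuous f) (p : ENNReal) : MemLp f p μΩ := by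
  obtain ⟨C, hC⟩ := isCompact_closedRect.exists_bound_of_continuousOn hf.continuousOn
  refine MemLp.of_bound hf.aestronglyMeasurable C ?_
  filter_upwards [ae_mem_Ω] with x hx using hC x (Ω_subset_Icc hx)

lemma integrable_of_continuous (hf : Continuous f) : Integrable f μΩ :=
  memLp_one_iff_integrable.1 (memLp_of_continuous hf 1)

lemma neg_pi_le_pi : -Real.pi ≤ Real.pi := by linarith [Real.pi_pos]

lemma integral_Ω (hf : Integrable f μΩ) :
    ∫ x, f x ∂μΩ = ∫ x in (-Real.pi)..Real.pi, ∫ y in (0 : ℝ)..Real.pi, f (x, y) := by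
  rw [μΩ_eq_prod] at hf ⊢
  rw [integral_prod _ hf, intervalIntegral.integral_of_le neg_pi_le_pi,
    integral_Ioc_eq_integral_Ioo]
  congr 1
  funext x
  rw [intervalIntegral.integral_of_le Real.pi_pos.le, integral_Ioc_eq_integral_Ioo]

lemma integral_Ω_swap (hf : Integrable f μΩ) :
    ∫ x, f x ∂μΩ = ∫ y in (0 : ℝ)..Real.pi, ∫ x in (-Real.pi)..Real.pi, f (x, y) := by
  rw [μΩ_eq_prod] at hf ⊢
  rw [integral_prod_symm _ hf, intervalIntegral.integral_of_le Real.pi_pos.le,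
    integral_Ioc_eq_integral_Ioo]
  congr 1
  funext x
  rw [intervalIntegral.integral_of_le neg_pi_le_pi, integral_Ioc_eq_integral_Ioo]

/-- The divergence theorem in the periodic direction. -/
lemma integral_deriv_fst_eq_zero {F F' : ℝ × ℝ → ℝ} (hF' : Continuous F')
    (hd : ∀ x y, HasDerivAt (fun t => F (t, y)) (F' (x, y)) x)
    (hb : ∀ y ∈ Icc 0 Real.pi, F (-Real.pi, y) = F (Real.pi, y)) :
    ∫ x, F' x ∂μΩ = 0 := by
  rw [integral_Ω_swap (integrable_of_continuous hF')]
  refine (intervalIntegral.integral_congr (g := fun _ => (0 : ℝ)) fun y hy => ?_).trans (by simp)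
  rw [uIcc_of_le Real.pi_pos.le] at hy
  simp only
  rw [intervalIntegral.integral_eq_sub_of_hasDerivAt (fun x _ => hd x y)
    ((hF'.comp (by fun_prop)).intervalIntegrable _ _), hb y hy, sub_self]

/-- The divergence theorem in the vertical direction. -/
lemma integral_deriv_snd_eq_zero {F F' : ℝ × ℝ → ℝ} (hF' : Continuous F')
    (hd : ∀ x y, HasDerivAt (fun t => F (x, t)) (F' (x, y)) y)
    (hb : ∀ x ∈ Icc (-Real.pi) Real.pi, F (x, 0) = F (x, Real.pi)) :
    ∫ x, F' x ∂μΩ = 0 := by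
  rw [integral_Ω (integrable_of_continuous hF')]
  refine (intervalIntegral.integral_congr (g := fun _ => (0 : ℝ)) fun x hx => ?_).trans (by simp)
  rw [uIcc_of_le neg_pi_le_pi] at hx
  simp only
  rw [intervalIntegral.integral_eq_sub_of_hasDerivAt (fun y _ => hd x y)
    ((hF'.comp (by fun_prop)).intervalIntegrable _ _), hb x hx, sub_self]

/-! ### The seminorm of `L₂(Ω)` on functions -/

/-- The `L₂(Ω)` seminorm of a function. -/
noncomputable def nrm (f : ℝ × ℝ → ℝ) : ℝ := (eLpNorm f 2 μΩ).toReal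

lemma nrm_nonneg (f : ℝ × ℝ → ℝ) : 0 ≤ nrm f := ENNReal.toReal_nonneg

lemma norm_eq_nrm (u : L2) : ‖u‖ = nrm u := Lp.norm_def u

lemma nrm_congr_ae (h : f =ᵐ[μΩ] g) : nrm f = nrm g := by
  rw [nrm, nrm, eLpNorm_congr_ae h]

lemma nrm_sq (hf : MemLp f 2 μΩ) : nrm f ^ 2 = ∫ x, f x ^ 2 ∂μΩ := by
  have h := hf.eLpNorm_eq_integral_rpow_norm (by norm_num) (by norm_num)
  have h0 : 0 ≤ ∫ x, f x ^ 2 ∂μΩ := integral_nonneg fun x => sq_nonneg _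
  have h1 : nrm f = √(∫ x, f x ^ 2 ∂μΩ) := by
    rw [nrm, h, ENNReal.toReal_ofReal (by positivity), Real.sqrt_eq_rpow]
    simp [Real.norm_eq_abs]
  rw [h1, Real.sq_sqrt h0]

lemma nrm_add_le (hf : MemLp f 2 μΩ) (hg : MemLp g 2 μΩ) : nrm (f + g) ≤ nrm f + nrm g := by
  rw [nrm, nrm, nrm, ← ENNReal.toReal_add hf.eLpNorm_ne_top hg.eLpNorm_ne_top]
  exact ENNReal.toReal_mono (by finiteness [hf.eLpNorm_ne_top, hg.eLpNorm_ne_top])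
    (eLpNorm_add_le hf.1 hg.1 (by norm_num))

lemma nrm_sub_comm (f g : ℝ × ℝ → ℝ) : nrm (f - g) = nrm (g - f) := by
  rw [nrm, nrm, eLpNorm_sub_comm]

/-- The Cauchy–Schwarz inequality. -/
lemma integral_abs_mul_le (hf : MemLp f 2 μΩ) (hg : MemLp g 2 μΩ) :
    ∫ x, |f x * g x| ∂μΩ ≤ nrm f * nrm g := by
  have h := integral_mul_norm_le_Lp_mul_Lq (μ := μΩ) (f := f) (g := g) (p := 2) (q := 2)
    (Real.HolderConjugate.two_two) (by simpa using hf) (by simpa using hg)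
  have h2 : ∀ {k : ℝ × ℝ → ℝ}, MemLp k 2 μΩ → (∫ a, ‖k a‖ ^ (2:ℝ) ∂μΩ) ^ (1 / (2:ℝ)) = nrm k := by
    intro k hk
    rw [← Real.sqrt_eq_rpow, Real.sqrt_eq_iff_mul_self_eq (integral_nonneg fun x => by positivity)
      (nrm_nonneg _), ← sq, nrm_sq hk]
    simp [Real.norm_eq_abs]
  rw [h2 hf, h2 hg] at h
  simpa [abs_mul] using h

lemma integrable_mul_of_memLp (hf : MemLp f 2 μΩ) (hg : MemLp g 2 μΩ) :
    Integrable (fun x => f x * g x) μΩ :=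
  hf.integrable_mul hg

end HydroFlow

namespace HydroFlow

open Filter Topology

/-! ### Weak derivatives -/

lemma IsTest.continuous {ψ : ℝ × ℝ → ℝ} (h : IsTest ψ) : Continuous ψ := h.contDiff.continuous

lemma IsTest.pd1 {ψ : ℝ × ℝ → ℝ} (h : IsTest ψ) : IsTest (pd1 ψ) where
  contDiff := contDiff_pd1 h.contDiff
  hasCompactSupport := h.hasCompactSupport.fderiv_apply ℝ (1, 0)
  tsupport_subset := (tsupport_fderiv_apply_subset ℝ (1, 0)).trans h.tsupport_subset

lemma IsTest.pd2 {ψ : ℝ × ℝ → ℝ} (h : IsTest ψ) : IsTest (pd2 ψ) where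
  contDiff := contDiff_pd2 h.contDiff
  hasCompactSupport := h.hasCompactSupport.fderiv_apply ℝ (0, 1)
  tsupport_subset := (tsupport_fderiv_apply_subset ℝ (0, 1)).trans h.tsupport_subset

lemma IsTest.pd {ψ : ℝ × ℝ → ℝ} (h : IsTest ψ) (a b : ℕ) : IsTest (pd a b ψ) := by
  induction a with
  | zero =>
    induction b with
    | zero => exact h
    | succ n ih => rw [pd_zero_succ]; exact ih.pd2
  | succ n ih => rw [pd_succ_left]; exact ih.pd1

/-- Since `ψ` is supported inside `Ω`, both integrals extend to the whole plane, where integration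
by parts has no boundary term. -/
lemma integral_mul_fderiv_test {φ ψ : ℝ × ℝ → ℝ} (hφ : ContDiff ℝ ∞ φ) (hψ : IsTest ψ)
    (v : ℝ × ℝ) :
    ∫ x, φ x * fderiv ℝ ψ x v ∂μΩ = -∫ x, fderiv ℝ φ x v * ψ x ∂μΩ := by
  have hψ' : Continuous fun x => fderiv ℝ ψ x v :=
    (hψ.contDiff.continuous_fderiv (by simp)).clm_apply continuous_const
  have hφ' : Continuous fun x => fderiv ℝ φ x v :=
    (hφ.continuous_fderiv (by simp)).clm_apply continuous_const
  have hc' : HasCompactSupport fun x => fderiv ℝ ψ x v := hψ.hasCompactSupport.fderiv_apply ℝ v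
  have e1 : ∫ x, φ x * fderiv ℝ ψ x v ∂μΩ = ∫ x, φ x * fderiv ℝ ψ x v := by
    refine setIntegral_eq_integral_of_forall_compl_eq_zero fun x hx => ?_
    have : x ∉ tsupport fun x => fderiv ℝ ψ x v := fun h =>
      hx (hψ.tsupport_subset (tsupport_fderiv_apply_subset ℝ v h))
    rw [image_eq_zero_of_notMem_tsupport this, mul_zero]
  have e2 : ∫ x, fderiv ℝ φ x v * ψ x ∂μΩ = ∫ x, fderiv ℝ φ x v * ψ x := by
    refine setIntegral_eq_integral_of_forall_compl_eq_zero fun x hx => ?_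
    have : x ∉ tsupport ψ := fun h => hx (hψ.tsupport_subset h)
    rw [image_eq_zero_of_notMem_tsupport this, mul_zero]
  rw [e1, e2]
  refine integral_mul_fderiv_eq_neg_fderiv_mul_of_integrable ?_ ?_ ?_
    (fun x _ => hφ.differentiable (by simp) x) (fun x _ => hψ.contDiff.differentiable (by simp) x)
  · exact (hφ'.mul hψ.continuous).integrable_of_hasCompactSupport hψ.hasCompactSupport.mul_left
  · exact (hφ.continuous.mul hψ').integrable_of_hasCompactSupport hc'.mul_left
  · exact (hφ.continuous.mul hψ.continuous).integrable_of_hasCompactSupport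
      hψ.hasCompactSupport.mul_left

/-- Integration by parts takes the outermost derivative off the test function and makes it the
innermost one on `φ`; symmetry of second derivatives restores the order used in `pd`. -/
lemma pd_pd1 {φ : ℝ × ℝ → ℝ} (hφ : ContDiff ℝ ∞ φ) (a b : ℕ) :
    pd a b (pd1 φ) = pd (a + 1) b φ := by
  have h : pd 0 b (pd1 φ) = pd1 (pd 0 b φ) := by
    induction b with
    | zero => rfl
    | succ n ih =>
      rw [pd_zero_succ, ih, ← pd1_pd2_comm (contDiff_pd 0 n hφ), ← pd_zero_succ]
  induction a with
  | zero => rw [h, ← pd_succ_left]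
  | succ n ih => rw [pd_succ_left, ih, ← pd_succ_left]

lemma integral_mul_pd_test {φ ψ : ℝ × ℝ → ℝ} (hφ : ContDiff ℝ ∞ φ) (hψ : IsTest ψ) (a b : ℕ) :
    ∫ x, φ x * pd a b ψ x ∂μΩ = (-1) ^ (a + b) * ∫ x, pd a b φ x * ψ x ∂μΩ := by
  induction a generalizing φ with
  | zero =>
    induction b generalizing φ with
    | zero => simp [pd]
    | succ n ih =>
      have h1 : ∫ x, φ x * pd 0 (n + 1) ψ x ∂μΩ = -∫ x, pd2 φ x * pd 0 n ψ x ∂μΩ := by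
        rw [pd_zero_succ]; exact integral_mul_fderiv_test hφ (hψ.pd 0 n) (0, 1)
      rw [h1, ih (contDiff_pd2 hφ)]
      have : pd 0 n (pd2 φ) = pd 0 (n + 1) φ := rfl
      rw [this]; ring
  | succ n ih =>
    have h1 : ∫ x, φ x * pd (n + 1) b ψ x ∂μΩ = -∫ x, pd1 φ x * pd n b ψ x ∂μΩ := by
      rw [pd_succ_left]; exact integral_mul_fderiv_test hφ (hψ.pd n b) (1, 0)
    rw [h1, ih (contDiff_pd1 hφ), pd_pd1 hφ]
    ring

/-- The fundamental lemma of the calculus of variations. It makes the choice in `wd` harmless: any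
weak derivative that can be exhibited is the value of `wd`. -/
lemma IsWeakDeriv.unique {a b : ℕ} {u g g' : L2} (h : IsWeakDeriv a b u g)
    (h' : IsWeakDeriv a b u g') : g = g' := by
  have hg : MemLp g 2 μΩ := Lp.memLp g
  have hg' : MemLp g' 2 μΩ := Lp.memLp g'
  have hi : IntegrableOn (fun x => g x - g' x) Ω volume := (hg.sub hg').integrable (by norm_num)
  have key : ∀ᵐ x ∂volume, x ∈ Ω → g x - g' x = 0 := by
    refine isOpen_Ω.ae_eq_zero_of_integral_contDiff_smul_eq_zero hi.locallyIntegrableOn ?_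
    intro ψ h1 h2 h3
    have hψ : IsTest ψ := ⟨h1, h2, h3⟩
    have e := (h ψ hψ).symm.trans (h' ψ hψ)
    have e' : ∫ x, g x * ψ x ∂μΩ = ∫ x, g' x * ψ x ∂μΩ :=
      mul_left_cancel₀ (pow_ne_zero _ (by norm_num)) e
    have hψm : MemLp ψ 2 μΩ := memLp_of_continuous h1.continuous 2
    have : ∫ x, ψ x • (g x - g' x) ∂μΩ = 0 := by
      rw [← sub_eq_zero, ← integral_sub (integrable_mul_of_memLp hg hψm)
        (integrable_mul_of_memLp hg' hψm)] at e'
      rw [← e']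
      refine integral_congr_ae (.of_forall fun x => ?_)
      simp only [smul_eq_mul]; ring
    rw [← this]
    refine (setIntegral_eq_integral_of_forall_compl_eq_zero fun x hx => ?_).symm
    have : x ∉ tsupport ψ := fun h => hx (h3 h)
    rw [image_eq_zero_of_notMem_tsupport this, zero_smul]
  refine Lp.ext ?_
  refine (ae_restrict_iff' measurableSet_Ω).2 ?_
  filter_upwards [key] with x hx hxΩ using sub_eq_zero.1 (hx hxΩ)

lemma IsWeakDeriv.wd_eq {a b : ℕ} {u g : L2} (h : IsWeakDeriv a b u g) : wd a b u = g := by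
  have hex : ∃ g : L2, IsWeakDeriv a b u g := ⟨g, h⟩
  rw [wd, dif_pos hex]
  exact hex.choose_spec.unique h

lemma isWeakDeriv_wd {a b : ℕ} {u : L2} (h : ∃ g : L2, IsWeakDeriv a b u g) :
    IsWeakDeriv a b u (wd a b u) := by
  rw [wd, dif_pos h]
  exact h.choose_spec

lemma IsWeakDeriv.sub {a b : ℕ} {u v g k : L2} (h : IsWeakDeriv a b u g)
    (h' : IsWeakDeriv a b v k) : IsWeakDeriv a b (u - v) (g - k) := by
  intro ψ hψ
  have hψm : MemLp ψ 2 μΩ := memLp_of_continuous hψ.continuous 2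
  have hψm' : MemLp (HydroFlow.pd a b ψ) 2 μΩ := memLp_of_continuous (hψ.pd a b).continuous 2
  have key : ∀ (p q : L2) {r : ℝ × ℝ → ℝ}, MemLp r 2 μΩ →
      ∫ x, (p - q : L2) x * r x ∂μΩ = ∫ x, p x * r x ∂μΩ - ∫ x, q x * r x ∂μΩ := by
    intro p q r hr
    rw [← integral_sub (integrable_mul_of_memLp (Lp.memLp p) hr)
      (integrable_mul_of_memLp (Lp.memLp q) hr)]
    refine integral_congr_ae ?_
    filter_upwards [Lp.coeFn_sub p q] with x hx
    rw [hx, Pi.sub_apply, sub_mul]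
  rw [key u v hψm', key g k hψm, h ψ hψ, h' ψ hψ, mul_sub]

lemma isWeakDeriv_zero_zero (u : L2) : IsWeakDeriv 0 0 u u := by
  intro ψ _
  simp [pd]

lemma wd_zero_zero (u : L2) : wd 0 0 u = u := (isWeakDeriv_zero_zero u).wd_eq

lemma isWeakDeriv_of_contDiff {φ : ℝ × ℝ → ℝ} (hφ : ContDiff ℝ ∞ φ) {f : L2} (hf : f =ᵐ[μΩ] φ)
    (a b : ℕ) :
    IsWeakDeriv a b f ((memLp_of_continuous (contDiff_pd a b hφ).continuous 2).toLp _) := by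
  intro ψ hψ
  have e1 : ∫ x, f x * pd a b ψ x ∂μΩ = ∫ x, φ x * pd a b ψ x ∂μΩ := by
    refine integral_congr_ae ?_
    filter_upwards [hf] with x hx
    rw [hx]
  rw [e1, integral_mul_pd_test hφ hψ]
  congr 1
  refine integral_congr_ae ?_
  filter_upwards [(memLp_of_continuous (contDiff_pd a b hφ).continuous 2).coeFn_toLp] with x hx
  rw [hx]

lemma norm_wd_le_hkNorm {k a b : ℕ} (h : a + b ≤ k) (u : L2) : ‖wd a b u‖ ≤ hkNorm k u := by
  refine Real.le_sqrt_of_sq_le ?_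
  have h1 := Finset.single_le_sum (f := fun b => ‖wd a b u‖ ^ 2) (s := Finset.range (k + 1 - a))
    (fun i _ => sq_nonneg _) (Finset.mem_range.2 (by omega : b < k + 1 - a))
  refine h1.trans ?_
  exact Finset.single_le_sum
    (f := fun a => ∑ b ∈ Finset.range (k + 1 - a), ‖wd a b u‖ ^ 2) (s := Finset.range (k + 1))
    (fun i _ => Finset.sum_nonneg fun _ _ => sq_nonneg _) (Finset.mem_range.2 (by omega))

/-- An element of `H_div^k(Ω)` is approximated, together with its weak derivatives, by smooth
functions. -/
lemma exists_smooth_approx {k : ℕ} {u : L2} (hu : u ∈ HDiv k) {ε : ℝ} (hε : 0 < ε) :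
    ∃ φ, IsSmoothDiv φ ∧ ∀ a b, a + b ≤ k → nrm (pd a b φ - wd a b u) ≤ ε := by
  obtain ⟨f, ⟨φ, hφ, hfφ⟩, hlt⟩ := hu.2 ε hε
  refine ⟨φ, hφ, fun a b hab => ?_⟩
  have hw := isWeakDeriv_of_contDiff hφ.contDiff hfφ a b
  have hs := ((isWeakDeriv_wd (hu.1 a b hab)).sub hw).wd_eq
  have h1 := (norm_wd_le_hkNorm hab (u - f)).trans hlt.le
  rw [hs, norm_eq_nrm] at h1
  rw [nrm_sub_comm]
  refine le_trans (le_of_eq (nrm_congr_ae ?_)) h1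
  filter_upwards [Lp.coeFn_sub (wd a b u)
    ((memLp_of_continuous (contDiff_pd a b hφ.contDiff).continuous 2).toLp _),
    (memLp_of_continuous (contDiff_pd a b hφ.contDiff).continuous 2).coeFn_toLp] with x hx hx'
  rw [hx, Pi.sub_apply, Pi.sub_apply, hx']

end HydroFlow

namespace HydroFlow

open Filter Topology

/-! ### One-dimensional inequalities -/

/-- Off `c` the function is `v` times a quotient of difference quotients of `v` and `sin`, times
`cos`. The quotient tends to `v' / cos c` and `v` tends to `0`, which is also the value at `c`. -/
lemma continuousAt_sq_mul_cot {v : ℝ → ℝ} {c v' : ℝ} (hv : HasDerivAt v v' c) (h0 : v c = 0)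
    (hs : Real.sin c = 0) : ContinuousAt (fun x => v x ^ 2 * (Real.cos x / Real.sin x)) c := by
  have hc : Real.cos c ≠ 0 := by
    intro h
    have := Real.sin_sq_add_cos_sq c
    rw [hs, h] at this
    norm_num at this
  rw [continuousAt_iff_punctured_nhds]
  have t1 := hasDerivAt_iff_tendsto_slope.1 hv
  have t2 := hasDerivAt_iff_tendsto_slope.1 (Real.hasDerivAt_sin c)
  have t3 : Tendsto v (𝓝[≠] c) (𝓝 (v c)) := hv.continuousAt.tendsto.mono_left nhdsWithin_le_nhds
  have t4 : Tendsto Real.cos (𝓝[≠] c) (𝓝 (Real.cos c)) :=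
    Real.continuous_cos.continuousAt.tendsto.mono_left nhdsWithin_le_nhds
  have t := (t3.mul (t1.div t2 hc)).mul t4
  simp only [h0, zero_mul] at t
  simp only [h0, ne_eq, OfNat.ofNat_ne_zero, not_false_eq_true, zero_pow, zero_mul]
  refine t.congr' ?_
  filter_upwards [self_mem_nhdsWithin] with x hx
  have hx' : x - c ≠ 0 := sub_ne_zero.2 hx
  simp only [Pi.div_apply, slope_def_field, h0, hs, sub_zero]
  rw [div_div_div_cancel_right₀ hx']
  ring

/-- The Wirtinger inequality on `(0, π)` with the sharp constant. -/
lemma integral_sq_le_integral_deriv_sq {v v' : ℝ → ℝ} (hv : ∀ x, HasDerivAt v (v' x) x)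
    (hv' : Continuous v') (h0 : v 0 = 0) (hπ : v Real.pi = 0) :
    ∫ x in (0 : ℝ)..Real.pi, v x ^ 2 ≤ ∫ x in (0 : ℝ)..Real.pi, v' x ^ 2 := by
  have hvc : Continuous v := continuous_iff_continuousAt.2 fun x => (hv x).continuousAt
  have hs : ∀ x ∈ Ioo 0 Real.pi, Real.sin x ≠ 0 := fun x hx => (Real.sin_pos_of_mem_Ioo hx).ne'
  have hd : ∀ x ∈ Ioo 0 Real.pi, HasDerivAt (fun x => v x ^ 2 * (Real.cos x / Real.sin x))
      (2 * v x * v' x * (Real.cos x / Real.sin x) -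
        v x ^ 2 * (1 + (Real.cos x / Real.sin x) ^ 2)) x := by
    intro x hx
    have h := ((hv x).pow 2).mul ((Real.hasDerivAt_cos x).div (Real.hasDerivAt_sin x) (hs x hx))
    refine h.congr_deriv ?_
    have := hs x hx
    simp only [Pi.div_apply, Pi.pow_apply]
    field_simp
    ring
  have hcont : ContinuousOn (fun x => v x ^ 2 * (Real.cos x / Real.sin x)) (Icc 0 Real.pi) := by
    intro x hx
    refine ContinuousAt.continuousWithinAt ?_
    rcases eq_or_lt_of_le hx.1 with rfl | h1
    · exact continuousAt_sq_mul_cot (hv 0) h0 Real.sin_zero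
    rcases eq_or_lt_of_le hx.2 with rfl | h2
    · exact continuousAt_sq_mul_cot (hv Real.pi) hπ Real.sin_pi
    · exact (hd x ⟨h1, h2⟩).continuousAt
  have hφ : Continuous fun x => v' x ^ 2 - v x ^ 2 := by fun_prop
  -- The derivative of `v² cot` equals `v'² - v² - (v' - v cot)²`, hence is at most `v'² - v²`; and
  -- `v² cot` is zero at both endpoints.
  have key := intervalIntegral.sub_le_integral_of_hasDeriv_right_of_le Real.pi_pos.le hcont
    (fun x hx => (hd x hx).hasDerivWithinAt) (hφ.integrableOn_Icc) (fun x _ => by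
      nlinarith [sq_nonneg (v' x - v x * (Real.cos x / Real.sin x))])
  rw [intervalIntegral.integral_sub ((by fun_prop : Continuous fun x => v' x ^ 2).intervalIntegrable _ _)
    ((by fun_prop : Continuous fun x => v x ^ 2).intervalIntegrable _ _)] at key
  simp only [hπ, h0] at key
  norm_num at key
  linarith

/-- Cauchy–Schwarz, by expanding the nonnegative integral of the square of `|h|` minus its mean. -/
lemma sq_integral_le {h : ℝ → ℝ} (hh : Continuous h) {y : ℝ} (hy : y ∈ Icc 0 Real.pi) :
    (∫ s in (0 : ℝ)..y, h s) ^ 2 ≤ Real.pi * ∫ s in (0 : ℝ)..Real.pi, h s ^ 2 := by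
  have hπ := Real.pi_pos
  set I := ∫ s in (0 : ℝ)..Real.pi, |h s| with hI
  have h1 : |∫ s in (0 : ℝ)..y, h s| ≤ I :=
    (intervalIntegral.abs_integral_le_integral_abs hy.1).trans
      (intervalIntegral.integral_mono_interval le_rfl hy.1 hy.2
        (.of_forall fun s => abs_nonneg _) (hh.abs.intervalIntegrable _ _))
  have h2 : 0 ≤ ∫ s in (0 : ℝ)..Real.pi, (|h s| - I / Real.pi) ^ 2 :=
    intervalIntegral.integral_nonneg hπ.le fun s _ => sq_nonneg _
  have h3 : ∫ s in (0 : ℝ)..Real.pi, (|h s| - I / Real.pi) ^ 2 =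
      (∫ s in (0 : ℝ)..Real.pi, h s ^ 2) - I ^ 2 / Real.pi := by
    have e : ∀ s, (|h s| - I / Real.pi) ^ 2 =
        h s ^ 2 - 2 * (I / Real.pi) * |h s| + (I / Real.pi) ^ 2 := by
      intro s; rw [← sq_abs (h s)]; ring
    simp_rw [e]
    rw [intervalIntegral.integral_add, intervalIntegral.integral_sub,
      intervalIntegral.integral_const_mul, ← hI, intervalIntegral.integral_const]
    · simp only [smul_eq_mul, sub_zero]
      field_simp
      ring
    all_goals exact Continuous.intervalIntegrable (by fun_prop) _ _
  rw [h3] at h2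
  have h4 : (∫ s in (0 : ℝ)..y, h s) ^ 2 ≤ I ^ 2 := by
    rw [← sq_abs]; exact pow_le_pow_left₀ (abs_nonneg _) h1 2
  have h5 : I ^ 2 / Real.pi ≤ ∫ s in (0 : ℝ)..Real.pi, h s ^ 2 := by linarith
  rw [div_le_iff₀ hπ] at h5
  linarith

/-- The derivative of `h²` is `2hh'`. The reference point `s` will be either a zero of `h` or a
variable that is averaged out. -/
lemma sq_le_sq_add_integral {h h' : ℝ → ℝ} (hd : ∀ x, HasDerivAt h (h' x) x)
    (hh' : Continuous h') {a b : ℝ} {s t : ℝ} (hs : s ∈ Icc a b) (ht : t ∈ Icc a b) :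
    h t ^ 2 ≤ h s ^ 2 + 2 * ∫ r in a..b, |h r * h' r| := by
  have hc : Continuous h := continuous_iff_continuousAt.2 fun x => (hd x).continuousAt
  have h1 : ∫ r in s..t, 2 * (h r * h' r) = h t ^ 2 - h s ^ 2 := by
    refine intervalIntegral.integral_eq_sub_of_hasDerivAt (f := fun r => h r ^ 2) (fun r _ => ?_)
      (Continuous.intervalIntegrable (by fun_prop) _ _)
    refine ((hd r).pow 2).congr_deriv ?_
    simp; ring
  have h2 : |∫ r in s..t, h r * h' r| ≤ ∫ r in a..b, |h r * h' r| := by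
    have h3 : |∫ r in s..t, h r * h' r| ≤ |∫ r in s..t, ‖h r * h' r‖| :=
      intervalIntegral.norm_integral_le_abs_integral_norm (f := fun r => h r * h' r)
    refine h3.trans ((intervalIntegral.abs_integral_mono_interval (c := a) (d := b) ?_ ?_ ?_).trans (le_of_eq ?_))
    · refine uIoc_subset_uIoc_of_uIcc_subset_uIcc ?_
      rw [uIcc_of_le (hs.1.trans hs.2)]
      exact uIcc_subset_Icc hs ht
    · exact .of_forall fun r => abs_nonneg _
    · exact Continuous.intervalIntegrable (by fun_prop) _ _
    · exact abs_of_nonneg (intervalIntegral.integral_nonneg (hs.1.trans hs.2) fun _ _ => abs_nonneg _)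
  rw [intervalIntegral.integral_const_mul] at h1
  have := (le_abs_self _).trans h2
  linarith

end HydroFlow

namespace HydroFlow

open Filter Topology

variable {f g : ℝ × ℝ → ℝ}

/-! ### Anisotropic estimates for smooth functions -/

lemma continuous_pd1 (hf : ContDiff ℝ ∞ f) : Continuous (pd1 f) := (contDiff_pd1 hf).continuous

lemma continuous_pd2 (hf : ContDiff ℝ ∞ f) : Continuous (pd2 f) := (contDiff_pd2 hf).continuous

lemma continuous_integral_snd (hf : Continuous f) :
    Continuous fun x => ∫ y in (0 : ℝ)..Real.pi, f (x, y) :=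
  intervalIntegral.continuous_parametric_intervalIntegral_of_continuous'
    (f := fun x y => f (x, y)) hf _ _

lemma nrm_sq_of_continuous (hf : Continuous f) : nrm f ^ 2 =
    ∫ x in (-Real.pi)..Real.pi, ∫ y in (0 : ℝ)..Real.pi, f (x, y) ^ 2 := by
  rw [nrm_sq (memLp_of_continuous hf 2), integral_Ω (integrable_of_continuous (hf.fun_pow 2))]

/-- The Poincaré inequality with the sharp constant. -/
lemma nrm_le_nrm_pd2 (hf : ContDiff ℝ ∞ f) (h0 : ∀ x ∈ Icc (-Real.pi) Real.pi, f (x, 0) = 0)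
    (hπ : ∀ x ∈ Icc (-Real.pi) Real.pi, f (x, Real.pi) = 0) : nrm f ≤ nrm (pd2 f) := by
  have hc := hf.continuous
  have hc2 := continuous_pd2 hf
  refine (sq_le_sq₀ (nrm_nonneg _) (nrm_nonneg _)).1 ?_
  rw [nrm_sq_of_continuous hc, nrm_sq_of_continuous hc2]
  refine intervalIntegral.integral_mono_on neg_pi_le_pi
    ((continuous_integral_snd (hc.fun_pow 2)).intervalIntegrable _ _)
    ((continuous_integral_snd (hc2.fun_pow 2)).intervalIntegrable _ _) fun x hx => ?_
  exact integral_sq_le_integral_deriv_sq (fun y => hasDerivAt_snd hf x y)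
    (hc2.comp (by fun_prop)) (h0 x hx) (hπ x hx)

/-- A uniform bound for the `L₂` norms of a function on vertical lines. -/
lemma integral_sq_snd_le (hf : ContDiff ℝ ∞ f) {x : ℝ} (hx : x ∈ Icc (-Real.pi) Real.pi) :
    ∫ y in (0 : ℝ)..Real.pi, f (x, y) ^ 2 ≤ 2 * nrm f * (nrm f + nrm (pd1 f)) := by
  have hc := hf.continuous
  have hc1 := continuous_pd1 hf
  have hπ := Real.pi_gt_three
  have hG : Continuous fun p : ℝ × ℝ => |f p * pd1 f p| := by fun_prop
  set J := ∫ p, |f p * pd1 f p| ∂μΩ with hJ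
  have hJle : J ≤ nrm f * nrm (pd1 f) :=
    integral_abs_mul_le (memLp_of_continuous hc 2) (memLp_of_continuous hc1 2)
  have hswap : Continuous fun y => ∫ t in (-Real.pi)..Real.pi, |f (t, y) * pd1 f (t, y)| := by
    refine intervalIntegral.continuous_parametric_intervalIntegral_of_continuous' ?_ _ _
    exact hG.comp (by fun_prop : Continuous fun p : ℝ × ℝ => (p.2, p.1))
  -- The line at `x` is compared with any other line at `x'`; integrating over `x'` then turns the
  -- line integral at `x'` into `nrm f ^ 2`.
  have h1 : ∀ x' ∈ Icc (-Real.pi) Real.pi, ∫ y in (0 : ℝ)..Real.pi, f (x, y) ^ 2 ≤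
      (∫ y in (0 : ℝ)..Real.pi, f (x', y) ^ 2) + 2 * J := by
    intro x' hx'
    have i1 : ∀ x, Continuous fun y => f (x, y) ^ 2 := fun x => by fun_prop
    rw [hJ, integral_Ω_swap (integrable_of_continuous hG), ← intervalIntegral.integral_const_mul,
      ← intervalIntegral.integral_add ((i1 x').intervalIntegrable _ _)
        ((hswap.const_mul 2).intervalIntegrable _ _)]
    refine intervalIntegral.integral_mono_on Real.pi_pos.le ((i1 x).intervalIntegrable _ _)
      (((i1 x').add (hswap.const_mul 2)).intervalIntegrable _ _) fun y _ => ?_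
    exact sq_le_sq_add_integral (fun t => hasDerivAt_fst hf t y) (hc1.comp (by fun_prop)) hx' hx
  have h2 : ∫ x' in (-Real.pi)..Real.pi, ∫ y in (0 : ℝ)..Real.pi, f (x, y) ^ 2 ≤
      ∫ x' in (-Real.pi)..Real.pi, ((∫ y in (0 : ℝ)..Real.pi, f (x', y) ^ 2) + 2 * J) := by
    refine intervalIntegral.integral_mono_on neg_pi_le_pi (by simp) ?_ h1
    exact ((continuous_integral_snd (hc.fun_pow 2)).fun_add continuous_const).intervalIntegrable _ _
  rw [intervalIntegral.integral_add ((continuous_integral_snd (hc.fun_pow 2)).intervalIntegrable _ _)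
    (by simp), ← nrm_sq_of_continuous hc, intervalIntegral.integral_const,
    intervalIntegral.integral_const] at h2
  simp only [smul_eq_mul] at h2
  set S := ∫ y in (0 : ℝ)..Real.pi, f (x, y) ^ 2
  have h3 : 2 * Real.pi * (S - 2 * J) ≤ nrm f ^ 2 := by linarith
  -- The factor `2π` exceeds `1` and is simply dropped.
  have h4 : S - 2 * J ≤ nrm f ^ 2 := by
    by_contra hlt
    push Not at hlt
    nlinarith [sq_nonneg (nrm f)]
  nlinarith [sq_nonneg (nrm f)]

/-- A product estimate: one factor is controlled on vertical lines, the other one has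
uniformly bounded `L₂` norms there. -/
lemma nrm_mul_sq_le (hf : Continuous f) (hg : ContDiff ℝ ∞ g) {a : ℝ → ℝ} (ha : Continuous a)
    (hfa : ∀ x ∈ Icc (-Real.pi) Real.pi, ∀ y ∈ Icc 0 Real.pi, f (x, y) ^ 2 ≤ a x) :
    nrm (fun x => f x * g x) ^ 2 ≤
      (∫ x in (-Real.pi)..Real.pi, a x) * (2 * nrm g * (nrm g + nrm (pd1 g))) := by
  have hgc := hg.continuous
  rw [nrm_sq_of_continuous (hf.fun_mul hgc), ← intervalIntegral.integral_mul_const]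
  refine intervalIntegral.integral_mono_on neg_pi_le_pi
    ((continuous_integral_snd ((hf.fun_mul hgc).fun_pow 2)).intervalIntegrable _ _)
    ((ha.mul continuous_const).intervalIntegrable _ _) fun x hx => ?_
  have ha0 : 0 ≤ a x := (sq_nonneg _).trans (hfa x hx 0 ⟨le_rfl, Real.pi_pos.le⟩)
  refine le_trans ?_ (mul_le_mul_of_nonneg_left (integral_sq_snd_le hg hx) ha0)
  rw [← intervalIntegral.integral_const_mul]
  refine intervalIntegral.integral_mono_on Real.pi_pos.le
    (Continuous.intervalIntegrable (by fun_prop) _ _)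
    (Continuous.intervalIntegrable (by fun_prop) _ _) fun y hy => ?_
  rw [mul_pow]
  exact mul_le_mul_of_nonneg_right (hfa x hx y hy) (sq_nonneg _)

/-- As `f` vanishes at the bottom, `f(x, y)²` is at most `2 ∫ |f ∂₂f|` along the vertical line,
which serves as `a x`. -/
lemma nrm_mul_sq_le_of_bottom (hf : ContDiff ℝ ∞ f) (hg : ContDiff ℝ ∞ g)
    (h0 : ∀ x ∈ Icc (-Real.pi) Real.pi, f (x, 0) = 0) :
    nrm (fun x => f x * g x) ^ 2 ≤
      2 * (nrm f * nrm (pd2 f)) * (2 * nrm g * (nrm g + nrm (pd1 g))) := by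
  have hc := hf.continuous
  have hc2 := continuous_pd2 hf
  have hG : Continuous fun p : ℝ × ℝ => |f p * pd2 f p| := by fun_prop
  have h := nrm_mul_sq_le (a := fun x => 2 * ∫ y in (0 : ℝ)..Real.pi, |f (x, y) * pd2 f (x, y)|)
    hc hg ((continuous_integral_snd hG).const_mul 2) (fun x hx y hy => by
      have := sq_le_sq_add_integral (fun t => hasDerivAt_snd hf x t) (hc2.comp (by fun_prop))
        (a := 0) (b := Real.pi) ⟨le_rfl, Real.pi_pos.le⟩ hy
      simpa [h0 x hx] using this)
  refine h.trans (mul_le_mul_of_nonneg_right ?_ ?_)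
  · rw [intervalIntegral.integral_const_mul, ← integral_Ω (integrable_of_continuous hG)]
    have := integral_abs_mul_le (memLp_of_continuous hc 2) (memLp_of_continuous hc2 2)
    linarith
  · have := nrm_nonneg g
    have := nrm_nonneg (pd1 g)
    positivity

/-! ### The vertical velocity -/

/-- `-∫₀^{x₂} h(x₁, s) ds`. -/
noncomputable def vint (h : ℝ × ℝ → ℝ) : ℝ × ℝ → ℝ := fun x => -∫ s in (0 : ℝ)..x.2, h (x.1, s)

lemma continuous_vint {h : ℝ × ℝ → ℝ} (hh : Continuous h) : Continuous (vint h) := by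
  refine Continuous.neg ?_
  refine intervalIntegral.continuous_parametric_intervalIntegral_of_continuous
    (f := fun (x : ℝ × ℝ) s => h (x.1, s)) ?_ continuous_snd
  exact hh.comp (by fun_prop : Continuous fun p : (ℝ × ℝ) × ℝ => (p.1.1, p.2))

lemma hasDerivAt_vint_snd {h : ℝ × ℝ → ℝ} (hh : Continuous h) (x y : ℝ) :
    HasDerivAt (fun t => vint h (x, t)) (-h (x, y)) y := by
  have hc : Continuous fun s => h (x, s) := hh.comp (by fun_prop)
  exact (intervalIntegral.integral_hasDerivAt_right (hc.intervalIntegrable _ _)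
    (hc.stronglyMeasurableAtFilter _ _) hc.continuousAt).neg

lemma vint_bottom (h : ℝ × ℝ → ℝ) (x : ℝ) : vint h (x, 0) = 0 := by simp [vint]

lemma vint_sub {h k : ℝ × ℝ → ℝ} (hh : Continuous h) (hk : Continuous k) :
    vint (h - k) = vint h - vint k := by
  funext x
  simp only [vint, Pi.sub_apply]
  rw [intervalIntegral.integral_sub (Continuous.intervalIntegrable (by fun_prop) _ _)
    (Continuous.intervalIntegrable (by fun_prop) _ _)]
  ring

/-- Cauchy–Schwarz on vertical lines bounds the primitive uniformly in `y`, so no derivative of `h`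
is needed. -/
lemma nrm_vint_mul_sq_le {h : ℝ × ℝ → ℝ} (hh : Continuous h) (hg : ContDiff ℝ ∞ g) :
    nrm (fun x => vint h x * g x) ^ 2 ≤
      Real.pi * nrm h ^ 2 * (2 * nrm g * (nrm g + nrm (pd1 g))) := by
  have h1 := nrm_mul_sq_le (a := fun x => Real.pi * ∫ y in (0 : ℝ)..Real.pi, h (x, y) ^ 2)
    (continuous_vint hh) hg ((continuous_integral_snd (hh.fun_pow 2)).const_mul _) (fun x _ y hy => by
      rw [vint, neg_sq]
      exact sq_integral_le (hh.comp (by fun_prop : Continuous fun s : ℝ => (x, s))) hy)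
  rwa [intervalIntegral.integral_const_mul, ← nrm_sq_of_continuous hh] at h1

end HydroFlow

namespace HydroFlow

open Filter Topology

variable {f φ γ η : ℝ × ℝ → ℝ}

/-! ### Boundary values -/

/-- The extension of `f` beyond the rectangle need not vanish, so at the corners only the derivative
within the closed segment is available; it is unique and agrees with `pd1 f`. -/
lemma pd1_eq_zero_of_eq_zero (hf : ContDiff ℝ ∞ f) {c : ℝ}
    (h : ∀ x ∈ Icc (-Real.pi) Real.pi, f (x, c) = 0) :
    ∀ x ∈ Icc (-Real.pi) Real.pi, pd1 f (x, c) = 0 := by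
  intro x hx
  have h1 := (hasDerivAt_fst hf x c).hasDerivWithinAt (s := Icc (-Real.pi) Real.pi)
  have h2 : HasDerivWithinAt (fun t => f (t, c)) 0 (Icc (-Real.pi) Real.pi) x :=
    (hasDerivWithinAt_const x _ (0 : ℝ)).congr (fun t ht => h t ht) (h x hx)
  exact (uniqueDiffOn_Icc (by linarith [Real.pi_pos]) x hx).eq_deriv _ h1 h2

lemma IsSmoothDiv.pd1_bottom (h : IsSmoothDiv φ) :
    ∀ x ∈ Icc (-Real.pi) Real.pi, pd1 φ (x, 0) = 0 :=
  pd1_eq_zero_of_eq_zero h.contDiff h.bottom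

lemma IsSmoothDiv.pd1_top (h : IsSmoothDiv φ) :
    ∀ x ∈ Icc (-Real.pi) Real.pi, pd1 φ (x, Real.pi) = 0 :=
  pd1_eq_zero_of_eq_zero h.contDiff h.top

lemma IsSmoothDiv.vint_top (h : IsSmoothDiv φ) :
    ∀ x ∈ Icc (-Real.pi) Real.pi, vint (pd1 φ) (x, Real.pi) = 0 := by
  intro x hx
  simp only [vint]
  rw [h.integral_eq_zero x hx, neg_zero]

lemma IsSmoothDiv.sub (h : IsSmoothDiv φ) (h' : IsSmoothDiv γ) : IsSmoothDiv (φ - γ) where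
  contDiff := h.contDiff.sub h'.contDiff
  periodic a b y hy := by
    rw [pd_sub a b h.contDiff h'.contDiff, Pi.sub_apply, Pi.sub_apply, h.periodic a b y hy,
      h'.periodic a b y hy]
  bottom x hx := by rw [Pi.sub_apply, h.bottom x hx, h'.bottom x hx, sub_zero]
  top x hx := by rw [Pi.sub_apply, h.top x hx, h'.top x hx, sub_zero]
  integral_eq_zero x hx := by
    rw [pd1_sub h.contDiff h'.contDiff]
    have hc := continuous_pd1 h.contDiff
    have hc' := continuous_pd1 h'.contDiff
    simp only [Pi.sub_apply]
    rw [intervalIntegral.integral_sub (Continuous.intervalIntegrable (by fun_prop) _ _)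
      (Continuous.intervalIntegrable (by fun_prop) _ _), h.integral_eq_zero x hx,
      h'.integral_eq_zero x hx, sub_zero]

/-! ### The gradient and the Laplacian of smooth functions -/

/-- `‖∇φ‖₂` for smooth functions. -/
noncomputable def smoothGrad (φ : ℝ × ℝ → ℝ) : ℝ := √(nrm (pd1 φ) ^ 2 + nrm (pd2 φ) ^ 2)

/-- `‖∂₁∇φ‖₂` for smooth functions. -/
noncomputable def smoothD1Grad (φ : ℝ × ℝ → ℝ) : ℝ :=
  √(nrm (pd1 (pd1 φ)) ^ 2 + nrm (pd1 (pd2 φ)) ^ 2)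

/-- `‖Δφ‖₂` for smooth functions. -/
noncomputable def smoothLap (φ : ℝ × ℝ → ℝ) : ℝ := nrm (pd1 (pd1 φ) + pd2 (pd2 φ))

lemma smoothGrad_nonneg (φ : ℝ × ℝ → ℝ) : 0 ≤ smoothGrad φ := Real.sqrt_nonneg _

lemma nrm_pd1_le_smoothGrad (φ : ℝ × ℝ → ℝ) : nrm (pd1 φ) ≤ smoothGrad φ :=
  Real.le_sqrt_of_sq_le (by linarith [sq_nonneg (nrm (pd2 φ))])

lemma nrm_pd2_le_smoothGrad (φ : ℝ × ℝ → ℝ) : nrm (pd2 φ) ≤ smoothGrad φ :=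
  Real.le_sqrt_of_sq_le (by linarith [sq_nonneg (nrm (pd1 φ))])

lemma IsSmoothDiv.nrm_le_smoothGrad (h : IsSmoothDiv φ) : nrm φ ≤ smoothGrad φ :=
  (nrm_le_nrm_pd2 h.contDiff h.bottom h.top).trans (nrm_pd2_le_smoothGrad φ)

lemma nrm_sq' (hf : Continuous f) : nrm f ^ 2 = ∫ x, f x ^ 2 ∂μΩ := nrm_sq (memLp_of_continuous hf 2)

/-- Integration by parts gives `‖∇φ‖² = -⟨φ, Δφ⟩ ≤ ‖φ‖ ‖Δφ‖`. The Poincaré inequality with constant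
`1` bounds `‖φ‖` by `‖∇φ‖`, which then cancels. -/
lemma IsSmoothDiv.smoothGrad_le_smoothLap (h : IsSmoothDiv φ) : smoothGrad φ ≤ smoothLap φ := by
  have c0 := h.contDiff.continuous
  have s1 := contDiff_pd1 h.contDiff
  have s2 := contDiff_pd2 h.contDiff
  have c1 := s1.continuous
  have c2 := s2.continuous
  have c11 := continuous_pd1 s1
  have c22 := continuous_pd2 s2
  have e1 : ∫ x, (pd1 φ x * pd1 φ x + φ x * pd1 (pd1 φ) x) ∂μΩ = 0 := by
    refine integral_deriv_fst_eq_zero (F := fun x => φ x * pd1 φ x) (by fun_prop)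
      (fun x y => (hasDerivAt_fst h.contDiff x y).mul (hasDerivAt_fst s1 x y)) fun y hy => ?_
    have p0 := h.periodic 0 0 y hy
    have p1 := h.periodic 1 0 y hy
    change φ _ = φ _ at p0
    change pd1 φ _ = pd1 φ _ at p1
    simp only [p0, p1]
  have e2 : ∫ x, (pd2 φ x * pd2 φ x + φ x * pd2 (pd2 φ) x) ∂μΩ = 0 := by
    refine integral_deriv_snd_eq_zero (F := fun x => φ x * pd2 φ x) (by fun_prop)
      (fun x y => (hasDerivAt_snd h.contDiff x y).mul (hasDerivAt_snd s2 x y)) fun x hx => ?_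
    simp only [h.bottom x hx, h.top x hx, zero_mul]
  have e3 : smoothGrad φ ^ 2 = -∫ x, φ x * (pd1 (pd1 φ) + pd2 (pd2 φ)) x ∂μΩ := by
    rw [smoothGrad, Real.sq_sqrt (by positivity), nrm_sq' c1, nrm_sq' c2, eq_neg_iff_add_eq_zero,
      ← integral_add (integrable_of_continuous (by fun_prop))
        (integrable_of_continuous (by fun_prop)),
      ← integral_add (integrable_of_continuous (by fun_prop))
        (integrable_of_continuous (by fun_prop))]
    -- The zero on the right is rewritten as the sum of the integrals in `e1` and `e2`, leaving a
    -- pointwise identity.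
    rw [← add_zero (0 : ℝ)]
    nth_rewrite 1 [← e1]
    rw [← e2, ← integral_add (integrable_of_continuous (by fun_prop))
        (integrable_of_continuous (by fun_prop))]
    refine integral_congr_ae (.of_forall fun x => ?_)
    simp only [Pi.add_apply]; ring
  have e4 : smoothGrad φ ^ 2 ≤ nrm φ * smoothLap φ := by
    rw [e3]
    refine le_trans ?_ (integral_abs_mul_le (memLp_of_continuous c0 2)
      (memLp_of_continuous (c11.add c22) 2))
    rw [← integral_neg]
    refine integral_mono (integrable_of_continuous (by fun_prop))
      (integrable_of_continuous (by fun_prop)) fun x => neg_le_abs _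
  by_contra hlt
  push Not at hlt
  have h0 := h.nrm_le_smoothGrad
  have := nrm_nonneg φ
  have : 0 ≤ smoothLap φ := nrm_nonneg _
  nlinarith [smoothGrad_nonneg φ]

/-- Two integrations by parts turn `∫ ∂₁²φ ∂₂²φ` into `∫ (∂₁∂₂φ)²`, so `‖Δφ‖² = ‖∂₁²φ‖² + 2‖∂₁∂₂φ‖²
+ ‖∂₂²φ‖²`. The horizontal sides contribute nothing because `∂₁²φ` vanishes there along with `φ`. -/
lemma IsSmoothDiv.smoothD1Grad_le_smoothLap (h : IsSmoothDiv φ) :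
    smoothD1Grad φ ≤ smoothLap φ := by
  have s1 := contDiff_pd1 h.contDiff
  have s2 := contDiff_pd2 h.contDiff
  have s11 := contDiff_pd1 s1
  have s12 := contDiff_pd1 s2
  have c2 := s2.continuous
  have c11 := s11.continuous
  have c12 := s12.continuous
  have c22 := continuous_pd2 s2
  have c112 := continuous_pd2 s11
  have c121 := continuous_pd1 s12
  have e1 : ∫ x, (pd1 (pd1 (pd2 φ)) x * pd2 φ x + pd1 (pd2 φ) x * pd1 (pd2 φ) x) ∂μΩ = 0 := by
    refine integral_deriv_fst_eq_zero (F := fun x => pd1 (pd2 φ) x * pd2 φ x) (by fun_prop)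
      (fun x y => (hasDerivAt_fst s12 x y).mul (hasDerivAt_fst s2 x y)) fun y hy => ?_
    have p0 := h.periodic 0 1 y hy
    have p1 := h.periodic 1 1 y hy
    change pd2 φ _ = pd2 φ _ at p0
    change pd1 (pd2 φ) _ = pd1 (pd2 φ) _ at p1
    simp only [p0, p1]
  have e2 : ∫ x, (pd2 (pd1 (pd1 φ)) x * pd2 φ x + pd1 (pd1 φ) x * pd2 (pd2 φ) x) ∂μΩ = 0 := by
    refine integral_deriv_snd_eq_zero (F := fun x => pd1 (pd1 φ) x * pd2 φ x) (by fun_prop)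
      (fun x y => (hasDerivAt_snd s11 x y).mul (hasDerivAt_snd s2 x y)) fun x hx => ?_
    simp only [pd1_eq_zero_of_eq_zero s1 h.pd1_bottom x hx,
      pd1_eq_zero_of_eq_zero s1 h.pd1_top x hx, zero_mul]
  have hcomm : pd1 (pd1 (pd2 φ)) = pd2 (pd1 (pd1 φ)) := by
    rw [pd1_pd2_comm h.contDiff, pd1_pd2_comm s1]
  rw [hcomm] at e1
  have e3 : ∫ x, pd1 (pd1 φ) x * pd2 (pd2 φ) x ∂μΩ = ∫ x, pd1 (pd2 φ) x ^ 2 ∂μΩ := by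
    rw [integral_add (integrable_of_continuous (by fun_prop))
        (integrable_of_continuous (by fun_prop))] at e1 e2
    simp only [sq]
    linarith
  have e4 : smoothLap φ ^ 2 = ∫ x, pd1 (pd1 φ) x ^ 2 ∂μΩ + 2 * ∫ x, pd1 (pd2 φ) x ^ 2 ∂μΩ
      + ∫ x, pd2 (pd2 φ) x ^ 2 ∂μΩ := by
    rw [smoothLap, nrm_sq' (c11.add c22), ← e3, ← integral_const_mul,
      ← integral_add (integrable_of_continuous (by fun_prop))
        (integrable_of_continuous (by fun_prop)),
      ← integral_add (integrable_of_continuous (by fun_prop))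
        (integrable_of_continuous (by fun_prop))]
    refine integral_congr_ae (.of_forall fun x => ?_)
    simp only [Pi.add_apply]; ring
  rw [← nrm_sq' c11, ← nrm_sq' c12, ← nrm_sq' c22] at e4
  refine (sq_le_sq₀ (Real.sqrt_nonneg _) (nrm_nonneg _)).1 ?_
  rw [Real.sq_sqrt (by positivity)]
  change _ ≤ smoothLap φ ^ 2
  nlinarith [sq_nonneg (nrm (pd1 (pd2 φ))), sq_nonneg (nrm (pd2 (pd2 φ)))]

/-! ### The nonlinearity on smooth functions -/

/-- `B(φ, γ)` for smooth functions. -/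
noncomputable def smoothB (φ γ : ℝ × ℝ → ℝ) : ℝ × ℝ → ℝ :=
  fun x => φ x * pd1 γ x + vint (pd1 φ) x * pd2 γ x

lemma continuous_smoothB (hφ : ContDiff ℝ ∞ φ) (hγ : ContDiff ℝ ∞ γ) :
    Continuous (smoothB φ γ) := by
  have := hφ.continuous
  have := continuous_pd1 hγ
  have := continuous_pd2 hγ
  have := continuous_vint (continuous_pd1 hφ)
  unfold smoothB
  fun_prop

lemma smoothB_sub_left (hφ : ContDiff ℝ ∞ φ) (hη : ContDiff ℝ ∞ η) (γ : ℝ × ℝ → ℝ) :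
    smoothB (φ - η) γ = smoothB φ γ - smoothB η γ := by
  funext x
  simp only [smoothB, pd1_sub hφ hη, vint_sub (continuous_pd1 hφ) (continuous_pd1 hη),
    Pi.sub_apply]
  ring

lemma smoothB_sub_right (φ : ℝ × ℝ → ℝ) (hγ : ContDiff ℝ ∞ γ) (hη : ContDiff ℝ ∞ η) :
    smoothB φ (γ - η) = smoothB φ γ - smoothB φ η := by
  funext x
  simp only [smoothB, pd1_sub hγ hη, pd2_sub hγ hη, Pi.sub_apply]
  ring

/-- Since `∂₂v_φ = -∂₁φ`, twice the integrand is `∂₁(φγ²) + ∂₂(v_φ γ²)`. The zero-mean condition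
makes `v_φ` vanish at the top. -/
lemma integral_smoothB_mul_self (hφ : IsSmoothDiv φ) (hγ : IsSmoothDiv γ) :
    ∫ x, smoothB φ γ x * γ x ∂μΩ = 0 := by
  have c0 := hφ.contDiff.continuous
  have c1 := continuous_pd1 hφ.contDiff
  have d0 := hγ.contDiff.continuous
  have d1 := continuous_pd1 hγ.contDiff
  have d2 := continuous_pd2 hγ.contDiff
  have cv := continuous_vint c1
  have e1 : ∫ x, (pd1 φ x * γ x ^ 2 + φ x * (2 * γ x * pd1 γ x)) ∂μΩ = 0 := by
    refine integral_deriv_fst_eq_zero (F := fun x => φ x * γ x ^ 2) (by fun_prop)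
      (fun x y => ?_) fun y hy => ?_
    · refine ((hasDerivAt_fst hφ.contDiff x y).mul
        ((hasDerivAt_fst hγ.contDiff x y).fun_pow 2)).congr_deriv ?_
      simp
    · have p0 := hφ.periodic 0 0 y hy
      have p1 := hγ.periodic 0 0 y hy
      change φ _ = φ _ at p0
      change γ _ = γ _ at p1
      simp only [p0, p1]
  have e2 : ∫ x, (-pd1 φ x * γ x ^ 2 + vint (pd1 φ) x * (2 * γ x * pd2 γ x)) ∂μΩ = 0 := by
    refine integral_deriv_snd_eq_zero (F := fun x => vint (pd1 φ) x * γ x ^ 2) (by fun_prop)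
      (fun x y => ?_) fun x hx => ?_
    · refine ((hasDerivAt_vint_snd c1 x y).mul
        ((hasDerivAt_snd hγ.contDiff x y).fun_pow 2)).congr_deriv ?_
      simp
    · simp only [vint_bottom, hφ.vint_top x hx, zero_mul]
  have e3 : 2 * ∫ x, smoothB φ γ x * γ x ∂μΩ = 0 := by
    rw [← integral_const_mul, ← add_zero (0 : ℝ)]
    nth_rewrite 1 [← e1]
    rw [← e2, ← integral_add (integrable_of_continuous (by fun_prop))
        (integrable_of_continuous (by fun_prop))]
    refine integral_congr_ae (.of_forall fun x => ?_)
    simp only [smoothB]; ring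
  linarith

/-- Twice the integrand is `∂₂(v_φ (∂₂φ)²) + 2∂₂(φ ∂₁φ ∂₂φ) - ∂₁(φ (∂₂φ)²)`. Although `∂₂φ` need not
vanish on the horizontal sides, its cofactors do. -/
lemma integral_smoothB_mul_pd2_pd2 (h : IsSmoothDiv φ) :
    ∫ x, smoothB φ φ x * pd2 (pd2 φ) x ∂μΩ = 0 := by
  have s1 := contDiff_pd1 h.contDiff
  have s2 := contDiff_pd2 h.contDiff
  have c0 := h.contDiff.continuous
  have c1 := s1.continuous
  have c2 := s2.continuous
  have c12 := continuous_pd1 s2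
  have c22 := continuous_pd2 s2
  have cv := continuous_vint c1
  have e1 : ∫ x, (pd1 φ x * pd2 φ x ^ 2 + φ x * (2 * pd2 φ x * pd1 (pd2 φ) x)) ∂μΩ = 0 := by
    refine integral_deriv_fst_eq_zero (F := fun x => φ x * pd2 φ x ^ 2) (by fun_prop)
      (fun x y => ?_) fun y hy => ?_
    · refine ((hasDerivAt_fst h.contDiff x y).mul
        ((hasDerivAt_fst s2 x y).fun_pow 2)).congr_deriv ?_
      simp
    · have p0 := h.periodic 0 0 y hy
      have p1 := h.periodic 0 1 y hy
      change φ _ = φ _ at p0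
      change pd2 φ _ = pd2 φ _ at p1
      simp only [p0, p1]
  have e2 : ∫ x, (-pd1 φ x * pd2 φ x ^ 2 + vint (pd1 φ) x * (2 * pd2 φ x * pd2 (pd2 φ) x)) ∂μΩ
      = 0 := by
    refine integral_deriv_snd_eq_zero (F := fun x => vint (pd1 φ) x * pd2 φ x ^ 2) (by fun_prop)
      (fun x y => ?_) fun x hx => ?_
    · refine ((hasDerivAt_vint_snd c1 x y).mul
        ((hasDerivAt_snd s2 x y).fun_pow 2)).congr_deriv ?_
      simp
    · simp only [vint_bottom, h.vint_top x hx, zero_mul]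
  have e3 : ∫ x, ((pd2 φ x * pd1 φ x + φ x * pd1 (pd2 φ) x) * pd2 φ x +
      φ x * pd1 φ x * pd2 (pd2 φ) x) ∂μΩ = 0 := by
    refine integral_deriv_snd_eq_zero (F := fun x => φ x * pd1 φ x * pd2 φ x) (by fun_prop)
      (fun x y => ?_) fun x hx => ?_
    · rw [pd1_pd2_comm h.contDiff]
      exact ((hasDerivAt_snd h.contDiff x y).fun_mul (hasDerivAt_snd s1 x y)).fun_mul
        (hasDerivAt_snd s2 x y)
    · simp only [h.bottom x hx, h.top x hx, zero_mul]
  have e4 : 2 * ∫ x, smoothB φ φ x * pd2 (pd2 φ) x ∂μΩ =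
      ∫ x, (-pd1 φ x * pd2 φ x ^ 2 + vint (pd1 φ) x * (2 * pd2 φ x * pd2 (pd2 φ) x)) ∂μΩ +
      2 * (∫ x, ((pd2 φ x * pd1 φ x + φ x * pd1 (pd2 φ) x) * pd2 φ x +
        φ x * pd1 φ x * pd2 (pd2 φ) x) ∂μΩ) -
      ∫ x, (pd1 φ x * pd2 φ x ^ 2 + φ x * (2 * pd2 φ x * pd1 (pd2 φ) x)) ∂μΩ := by
    rw [← integral_const_mul, ← integral_const_mul,
      ← integral_add (integrable_of_continuous (by fun_prop))
        (integrable_of_continuous (by fun_prop)),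
      ← integral_sub (integrable_of_continuous (by fun_prop))
        (integrable_of_continuous (by fun_prop))]
    refine integral_congr_ae (.of_forall fun x => ?_)
    simp only [smoothB]; ring
  rw [e1, e2, e3] at e4
  linarith

end HydroFlow

namespace HydroFlow

open Filter Topology

variable {f φ γ η : ℝ × ℝ → ℝ}

lemma nrm_pd1_pd2_le_smoothD1Grad (φ : ℝ × ℝ → ℝ) : nrm (pd1 (pd2 φ)) ≤ smoothD1Grad φ :=
  Real.le_sqrt_of_sq_le (by linarith [sq_nonneg (nrm (pd1 (pd1 φ)))])

/-! ### Estimates for the nonlinearity on smooth functions -/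

/-- Stated for numbers so that it serves smooth functions and the closures alike: `n, D, d` stand
for `‖u‖, ‖∇u‖, ‖∂₁u‖` and `v₁, v₂, D₁, E, Λ` for `‖∂₁v‖, ‖∂₂v‖, ‖∂₁∇v‖, ‖∇v‖, ‖Δv‖`. The constant
is `9 = 3 · (1 + 2)`. -/
lemma nonlinearity_bound_le {n D d v₁ v₂ D₁ E Λ : ℝ} (hn : 0 ≤ n) (hnD : n ≤ D)
    (hdD : d ≤ D) (h₁ : v₁ ≤ E) (h₂ : v₂ ≤ E) (hD₁ : D₁ ≤ Λ) (hEΛ : E ≤ Λ) :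
    3 * (√n * √D * √v₁ * √D₁ + d * √v₂ * (√v₂ + √D₁)) ≤ 9 * D * √E * √Λ := by
  have hD : 0 ≤ D := hn.trans hnD
  have a1 : √n * √D ≤ D := by
    calc √n * √D ≤ √D * √D := by gcongr
      _ = D := Real.mul_self_sqrt hD
  have a2 : √n * √D * √v₁ * √D₁ ≤ D * √E * √Λ := by gcongr
  have a3 : √v₂ + √D₁ ≤ 2 * √Λ := by
    have : √v₂ ≤ √Λ := Real.sqrt_le_sqrt (h₂.trans hEΛ)
    have : √D₁ ≤ √Λ := Real.sqrt_le_sqrt hD₁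
    linarith
  have a4 : d * √v₂ * (√v₂ + √D₁) ≤ D * √E * (2 * √Λ) := by gcongr
  linarith

/-- In the first product `∂₁γ` is the factor vanishing at the bottom and `φ` the one bounded on
vertical lines; in the second `∂₂γ` takes the latter role. The squared constants are `8` and `2π`,
both at most `3²`. -/
lemma nrm_smoothB_le (hφ : IsSmoothDiv φ) (hγ : IsSmoothDiv γ) :
    nrm (smoothB φ γ) ≤ 3 * (√(nrm φ) * √(smoothGrad φ) * √(nrm (pd1 γ)) * √(smoothD1Grad γ) +
      nrm (pd1 φ) * √(nrm (pd2 γ)) * (√(nrm (pd2 γ)) + √(smoothD1Grad γ))) := by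
  have s1 := contDiff_pd1 hγ.contDiff
  have s2 := contDiff_pd2 hγ.contDiff
  have c0 := hφ.contDiff.continuous
  have c1 := continuous_pd1 hφ.contDiff
  have d1 := s1.continuous
  have d2 := s2.continuous
  have cv := continuous_vint c1
  have hφD := hφ.nrm_le_smoothGrad
  have hφ1 := nrm_pd1_le_smoothGrad φ
  have n0 := nrm_nonneg φ
  have n1 := nrm_nonneg (pd1 φ)
  have m1 := nrm_nonneg (pd1 γ)
  have m2 := nrm_nonneg (pd2 γ)
  have hD1 := nrm_pd1_pd2_le_smoothD1Grad γ
  have m12 := nrm_nonneg (pd1 (pd2 γ))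
  have hD0 : 0 ≤ smoothD1Grad γ := Real.sqrt_nonneg _
  have hG0 := smoothGrad_nonneg φ
  have t1 : nrm (fun x => pd1 γ x * φ x) ≤
      3 * (√(nrm φ) * √(smoothGrad φ) * √(nrm (pd1 γ)) * √(smoothD1Grad γ)) := by
    have h := nrm_mul_sq_le_of_bottom s1 hφ.contDiff hγ.pd1_bottom
    rw [← pd1_pd2_comm hγ.contDiff] at h
    refine (sq_le_sq₀ (nrm_nonneg _) (by positivity)).1 (h.trans ?_)
    rw [mul_pow, mul_pow, mul_pow, mul_pow, Real.sq_sqrt n0, Real.sq_sqrt hG0, Real.sq_sqrt m1,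
      Real.sq_sqrt hD0]
    calc 2 * (nrm (pd1 γ) * nrm (pd1 (pd2 γ))) * (2 * nrm φ * (nrm φ + nrm (pd1 φ)))
        ≤ 2 * (nrm (pd1 γ) * smoothD1Grad γ) *
          (2 * nrm φ * (smoothGrad φ + smoothGrad φ)) := by gcongr
      _ = 8 * (nrm φ * smoothGrad φ * nrm (pd1 γ) * smoothD1Grad γ) := by ring
      _ ≤ 3 ^ 2 * (nrm φ * smoothGrad φ * nrm (pd1 γ) * smoothD1Grad γ) := by gcongr; norm_num
  have t2 : nrm (fun x => vint (pd1 φ) x * pd2 γ x) ≤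
      3 * (nrm (pd1 φ) * √(nrm (pd2 γ)) * (√(nrm (pd2 γ)) + √(smoothD1Grad γ))) := by
    have h := nrm_vint_mul_sq_le c1 s2
    refine (sq_le_sq₀ (nrm_nonneg _) (by positivity)).1 (h.trans ?_)
    rw [mul_pow, mul_pow, mul_pow, Real.sq_sqrt m2]
    have e : nrm (pd2 γ) + nrm (pd1 (pd2 γ)) ≤ (√(nrm (pd2 γ)) + √(smoothD1Grad γ)) ^ 2 := by
      rw [add_sq, Real.sq_sqrt m2, Real.sq_sqrt hD0]
      have : 0 ≤ 2 * √(nrm (pd2 γ)) * √(smoothD1Grad γ) := by positivity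
      linarith
    have hπ : Real.pi ≤ 9 / 2 := by linarith [Real.pi_le_four]
    calc Real.pi * nrm (pd1 φ) ^ 2 * (2 * nrm (pd2 γ) * (nrm (pd2 γ) + nrm (pd1 (pd2 γ))))
        ≤ 9 / 2 * nrm (pd1 φ) ^ 2 *
          (2 * nrm (pd2 γ) * (√(nrm (pd2 γ)) + √(smoothD1Grad γ)) ^ 2) := by gcongr
      _ = 3 ^ 2 * (nrm (pd1 φ) ^ 2 * nrm (pd2 γ) * (√(nrm (pd2 γ)) + √(smoothD1Grad γ)) ^ 2) := by
        ring
  have t3 : nrm (smoothB φ γ) ≤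
      nrm (fun x => pd1 γ x * φ x) + nrm (fun x => vint (pd1 φ) x * pd2 γ x) := by
    refine le_trans (le_of_eq ?_) (nrm_add_le (memLp_of_continuous (d1.mul c0) 2)
      (memLp_of_continuous (cv.mul d2) 2))
    congr 1
    funext x
    simp only [smoothB, Pi.add_apply]; ring
  linarith

/-- A cruder bound without square roots, suited to differences of approximating functions. -/
lemma nrm_smoothB_le_smoothLap (hφ : IsSmoothDiv φ) (hγ : IsSmoothDiv γ) :
    nrm (smoothB φ γ) ≤ 9 * smoothGrad φ * smoothLap γ := by
  have h := (nrm_smoothB_le hφ hγ).trans (nonlinearity_bound_le (nrm_nonneg φ)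
    hφ.nrm_le_smoothGrad (nrm_pd1_le_smoothGrad φ)
    (nrm_pd1_le_smoothGrad γ) (nrm_pd2_le_smoothGrad γ) hγ.smoothD1Grad_le_smoothLap
    hγ.smoothGrad_le_smoothLap)
  have h0 := smoothGrad_nonneg φ
  have hL : 0 ≤ smoothLap γ := nrm_nonneg _
  calc nrm (smoothB φ γ) ≤ 9 * smoothGrad φ * √(smoothGrad γ) * √(smoothLap γ) := h
    _ ≤ 9 * smoothGrad φ * √(smoothLap γ) * √(smoothLap γ) := by
      gcongr; exact hγ.smoothGrad_le_smoothLap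
    _ = 9 * smoothGrad φ * smoothLap γ := by rw [mul_assoc, Real.mul_self_sqrt hL]

/-- Grouping `η` with the coefficients `φ` and `v_φ` leaves only first derivatives of `γ`, to which
Cauchy–Schwarz applies. The two products contribute `3 ≥ √8` and `4`. -/
lemma integral_abs_smoothB_mul_le (hφ : IsSmoothDiv φ) (hγ : IsSmoothDiv γ)
    (hη : IsSmoothDiv η) :
    ∫ x, |smoothB φ γ x * η x| ∂μΩ ≤ 7 * smoothGrad φ * smoothGrad γ * smoothGrad η := by
  have c0 := hφ.contDiff.continuous
  have c1 := continuous_pd1 hφ.contDiff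
  have d1 := continuous_pd1 hγ.contDiff
  have d2 := continuous_pd2 hγ.contDiff
  have e0 := hη.contDiff.continuous
  have cv := continuous_vint c1
  have hφD := hφ.nrm_le_smoothGrad
  have hφ1 := nrm_pd1_le_smoothGrad φ
  have hφ2 := nrm_pd2_le_smoothGrad φ
  have hηD := hη.nrm_le_smoothGrad
  have hη1 := nrm_pd1_le_smoothGrad η
  have n0 := nrm_nonneg φ
  have n1 := nrm_nonneg (pd1 φ)
  have n2 := nrm_nonneg (pd2 φ)
  have k0 := nrm_nonneg η
  have k1 := nrm_nonneg (pd1 η)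
  have hG0 := smoothGrad_nonneg φ
  have hG1 := smoothGrad_nonneg γ
  have hG2 := smoothGrad_nonneg η
  have t1 : nrm (fun x => φ x * η x) ≤ 3 * (smoothGrad φ * smoothGrad η) := by
    refine (sq_le_sq₀ (nrm_nonneg _) (by positivity)).1
      ((nrm_mul_sq_le_of_bottom hφ.contDiff hη.contDiff hφ.bottom).trans ?_)
    calc 2 * (nrm φ * nrm (pd2 φ)) * (2 * nrm η * (nrm η + nrm (pd1 η)))
        ≤ 2 * (smoothGrad φ * smoothGrad φ) *
          (2 * smoothGrad η * (smoothGrad η + smoothGrad η)) := by gcongr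
      _ = 8 * (smoothGrad φ * smoothGrad η) ^ 2 := by ring
      _ ≤ 9 * (smoothGrad φ * smoothGrad η) ^ 2 := by gcongr; norm_num
      _ = (3 * (smoothGrad φ * smoothGrad η)) ^ 2 := by ring
  have t2 : nrm (fun x => vint (pd1 φ) x * η x) ≤ 4 * (smoothGrad φ * smoothGrad η) := by
    refine (sq_le_sq₀ (nrm_nonneg _) (by positivity)).1
      ((nrm_vint_mul_sq_le c1 hη.contDiff).trans ?_)
    calc Real.pi * nrm (pd1 φ) ^ 2 * (2 * nrm η * (nrm η + nrm (pd1 η)))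
        ≤ 4 * smoothGrad φ ^ 2 *
          (2 * smoothGrad η * (smoothGrad η + smoothGrad η)) := by
          gcongr; exact Real.pi_le_four
      _ = (4 * (smoothGrad φ * smoothGrad η)) ^ 2 := by ring
  have t3 : ∫ x, |smoothB φ γ x * η x| ∂μΩ ≤
      ∫ x, |(φ x * η x) * pd1 γ x| ∂μΩ + ∫ x, |(vint (pd1 φ) x * η x) * pd2 γ x| ∂μΩ := by
    rw [← integral_add (integrable_of_continuous (by fun_prop))
      (integrable_of_continuous (by fun_prop))]
    have := continuous_smoothB hφ.contDiff hγ.contDiff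
    refine integral_mono (integrable_of_continuous (by fun_prop))
      (integrable_of_continuous (by fun_prop)) fun x => ?_
    refine le_trans (le_of_eq ?_) (abs_add_le _ _)
    simp only [smoothB]
    congr 1
    ring
  have t4 := integral_abs_mul_le (memLp_of_continuous (c0.mul e0) 2) (memLp_of_continuous d1 2)
  have t5 := integral_abs_mul_le (memLp_of_continuous (cv.mul e0) 2) (memLp_of_continuous d2 2)
  calc ∫ x, |smoothB φ γ x * η x| ∂μΩ
      ≤ nrm (fun x => φ x * η x) * nrm (pd1 γ) +
        nrm (fun x => vint (pd1 φ) x * η x) * nrm (pd2 γ) := t3.trans (add_le_add t4 t5)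
    _ ≤ 3 * (smoothGrad φ * smoothGrad η) * smoothGrad γ +
        4 * (smoothGrad φ * smoothGrad η) * smoothGrad γ := by
      have := nrm_nonneg (pd1 γ)
      have := nrm_nonneg (pd2 γ)
      gcongr
      · exact nrm_pd1_le_smoothGrad γ
      · exact nrm_pd2_le_smoothGrad γ
    _ = 7 * smoothGrad φ * smoothGrad γ * smoothGrad η := by ring

end HydroFlow

namespace HydroFlow

open Filter Topology

variable {f g h : ℝ × ℝ → ℝ} {u : L2} {k : ℕ}

/-! ### Passing to the limit in the vertical velocity -/

/-- `∫₀^π |h(x₁, s)| ds`. -/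
noncomputable def absLineIntegral (h : ℝ × ℝ → ℝ) : ℝ × ℝ → ℝ :=
  fun x => ∫ s in Ioo 0 Real.pi, |h (x.1, s)|

lemma absLineIntegral_nonneg (h : ℝ × ℝ → ℝ) (x : ℝ × ℝ) : 0 ≤ absLineIntegral h x :=
  integral_nonneg fun _ => abs_nonneg _

lemma integrable_absLineIntegral (hh : Integrable h μΩ) : Integrable (absLineIntegral h) μΩ := by
  rw [μΩ_eq_prod] at hh ⊢
  exact hh.integral_norm_prod_left.comp_fst _

lemma integral_absLineIntegral (hh : Integrable h μΩ) :
    ∫ x, absLineIntegral h x ∂μΩ = Real.pi * ∫ x, |h x| ∂μΩ := by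
  have h2 := hh.abs
  rw [μΩ_eq_prod] at h2 ⊢
  rw [integral_prod _ h2]
  unfold absLineIntegral
  rw [integral_fun_fst (fun x => ∫ s in Ioo 0 Real.pi, |h (x, s)|)]
  simp [Real.pi_pos.le]

lemma ae_integrableOn_slice (hh : Integrable h μΩ) :
    ∀ᵐ x ∂μΩ, IntegrableOn (fun s => h (x.1, s)) (Ioo 0 Real.pi) volume := by
  rw [μΩ_eq_prod] at hh ⊢
  exact Measure.quasiMeasurePreserving_fst.ae hh.prod_right_ae

/-- The function `h` is only integrable, so its vertical slices are integrable for almost every `x₁`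
by Fubini. The bound no longer depends on `x₂`, and its `L₁` norm is `π` times that of `g - h`. -/
lemma ae_abs_vint_sub_le (hg : Continuous g) (hh : Integrable h μΩ) :
    ∀ᵐ x ∂μΩ, |vint g x - vint h x| ≤ absLineIntegral (g - h) x := by
  filter_upwards [ae_integrableOn_slice hh, ae_mem_Ω] with x hx hxΩ
  have hy : x.2 ∈ Ioo 0 Real.pi := hxΩ.2
  have hgx : IntegrableOn (fun s => g (x.1, s)) (Ioo 0 Real.pi) volume :=
    (Continuous.integrableOn_Icc (by fun_prop)).mono_set Ioo_subset_Icc_self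
  have hsub : Ioo 0 x.2 ⊆ Ioo 0 Real.pi := Ioo_subset_Ioo_right hy.2.le
  have e : vint g x - vint h x = -∫ s in Ioo 0 x.2, (g - h) (x.1, s) := by
    simp only [vint, Pi.sub_apply]
    rw [intervalIntegral.integral_of_le hy.1.le, intervalIntegral.integral_of_le hy.1.le,
      integral_Ioc_eq_integral_Ioo, integral_Ioc_eq_integral_Ioo,
      integral_sub (hgx.mono_set hsub) (hx.mono_set hsub)]
    ring
  rw [e, abs_neg]
  refine abs_integral_le_integral_abs.trans ?_
  exact setIntegral_mono_set (hgx.sub hx).abs (.of_forall fun s => abs_nonneg _)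
    hsub.eventuallyLE

/-! ### Approximation by smooth functions -/

lemma integral_abs_le_nrm (hf : MemLp f 2 μΩ) :
    ∫ x, |f x| ∂μΩ ≤ nrm f * nrm (fun _ => 1) := by
  simpa using integral_abs_mul_le hf (memLp_const (1 : ℝ))

/-- The sequence `φ` of smooth functions approximates `u` in `H_div^k(Ω)`, together with pointwise
convergence almost everywhere. -/
structure Approximates (k : ℕ) (u : L2) (φ : ℕ → ℝ × ℝ → ℝ) : Prop where
  smooth : ∀ n, IsSmoothDiv (φ n)
  nrm_sub_le : ∀ n a b, a + b ≤ k → nrm (pd a b (φ n) - wd a b u) ≤ 1 / ((n : ℝ) + 1)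
  ae_tendsto : ∀ᵐ x ∂μΩ, Tendsto (fun n => φ n x) atTop (𝓝 (u x))
  ae_tendsto_pd1 : ∀ᵐ x ∂μΩ, Tendsto (fun n => pd1 (φ n) x) atTop (𝓝 (wd 1 0 u x))
  ae_tendsto_pd2 : ∀ᵐ x ∂μΩ, Tendsto (fun n => pd2 (φ n) x) atTop (𝓝 (wd 0 1 u x))
  ae_tendsto_vint : ∀ᵐ x ∂μΩ, Tendsto (fun n => vint (pd1 (φ n)) x) atTop (𝓝 (vel u x))

lemma memLp_pd_sub {φ : ℝ × ℝ → ℝ} (hφ : IsSmoothDiv φ) (a b : ℕ) (w : L2) :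
    MemLp (pd a b φ - (w : ℝ × ℝ → ℝ)) 2 μΩ :=
  (memLp_of_continuous (contDiff_pd a b hφ.contDiff).continuous 2).sub (Lp.memLp w)

lemma exists_subseq_ae_tendsto_zero {H : ℕ → ℝ × ℝ → ℝ} (hH : ∀ n, Integrable (H n) μΩ)
    (hlim : Tendsto (fun n => ∫ x, |H n x| ∂μΩ) atTop (𝓝 0)) :
    ∃ ns : ℕ → ℕ, StrictMono ns ∧ ∀ᵐ x ∂μΩ, Tendsto (fun i => H (ns i) x) atTop (𝓝 0) := by
  have hm : TendstoInMeasure μΩ H atTop (fun _ => (0 : ℝ)) := by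
    refine tendstoInMeasure_of_tendsto_eLpNorm one_ne_zero (fun n => (hH n).1)
      aestronglyMeasurable_const ?_
    have e : ∀ n, eLpNorm (H n - fun _ => (0 : ℝ)) 1 μΩ = ENNReal.ofReal (∫ x, |H n x| ∂μΩ) := by
      intro n
      rw [eLpNorm_one_eq_lintegral_enorm, ← ofReal_integral_norm_eq_lintegral_enorm]
      · simp [Real.norm_eq_abs]
      · exact (hH n).sub (integrable_const 0)
    simp_rw [e]
    simpa [Function.comp_def] using (ENNReal.continuous_ofReal.tendsto 0).comp hlim
  exact hm.exists_seq_tendsto_ae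

lemma exists_approximates (hk : 1 ≤ k) (hu : u ∈ HDiv k) : ∃ φ, Approximates k u φ := by
  have hex : ∀ n : ℕ, ∃ φ, IsSmoothDiv φ ∧
      ∀ a b, a + b ≤ k → nrm (pd a b φ - wd a b u) ≤ 1 / ((n : ℝ) + 1) :=
    fun n => exists_smooth_approx hu (by positivity)
  choose φ hφ hd using hex
  have hm : ∀ n a b, Integrable (pd a b (φ n) - (wd a b u : ℝ × ℝ → ℝ)) μΩ := fun n a b =>
    (memLp_pd_sub (hφ n) a b _).integrable (by norm_num)
  -- One function dominates all four pointwise errors, so a single subsequence serves all of them.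
  let H : ℕ → ℝ × ℝ → ℝ := fun n x => |(pd 0 0 (φ n) - wd 0 0 u) x| +
    |(pd 1 0 (φ n) - wd 1 0 u) x| + |(pd 0 1 (φ n) - wd 0 1 u) x| +
    absLineIntegral (pd 1 0 (φ n) - wd 1 0 u) x
  have hH : ∀ n, Integrable (H n) μΩ := fun n =>
    (((hm n 0 0).abs.add (hm n 1 0).abs).add (hm n 0 1).abs).add
      (integrable_absLineIntegral (hm n 1 0))
  have hH0 : ∀ n x, 0 ≤ H n x := fun n x => by
    have := absLineIntegral_nonneg (pd 1 0 (φ n) - wd 1 0 u) x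
    positivity
  set c := nrm (fun _ => 1) with hc
  have hc0 : 0 ≤ c := nrm_nonneg _
  have hlim : Tendsto (fun n => ∫ x, |H n x| ∂μΩ) atTop (𝓝 0) := by
    have hb : ∀ n, ∫ x, |H n x| ∂μΩ ≤ (3 + Real.pi) * c * (1 / ((n : ℝ) + 1)) := by
      intro n
      have i : ∀ a b, a + b ≤ k → ∫ x, |(pd a b (φ n) - wd a b u) x| ∂μΩ ≤
          c * (1 / ((n : ℝ) + 1)) := fun a b hab => by
        refine (integral_abs_le_nrm (memLp_pd_sub (hφ n) a b _)).trans ?_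
        rw [mul_comm]
        exact mul_le_mul_of_nonneg_left (hd n a b hab) hc0
      have e : ∫ x, |H n x| ∂μΩ = ∫ x, |(pd 0 0 (φ n) - wd 0 0 u) x| ∂μΩ +
          ∫ x, |(pd 1 0 (φ n) - wd 1 0 u) x| ∂μΩ + ∫ x, |(pd 0 1 (φ n) - wd 0 1 u) x| ∂μΩ +
          Real.pi * ∫ x, |(pd 1 0 (φ n) - wd 1 0 u) x| ∂μΩ := by
        simp_rw [fun x => abs_of_nonneg (hH0 n x)]
        have h1 : Integrable (fun x => |(pd 0 0 (φ n) - wd 0 0 u) x| +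
            |(pd 1 0 (φ n) - wd 1 0 u) x|) μΩ := (hm n 0 0).abs.add (hm n 1 0).abs
        have h2 : Integrable (fun x => |(pd 0 0 (φ n) - wd 0 0 u) x| +
            |(pd 1 0 (φ n) - wd 1 0 u) x| + |(pd 0 1 (φ n) - wd 0 1 u) x|) μΩ :=
          h1.add (hm n 0 1).abs
        rw [← integral_absLineIntegral (hm n 1 0), ← integral_add (hm n 0 0).abs (hm n 1 0).abs,
          ← integral_add h1 (hm n 0 1).abs,
          ← integral_add h2 (integrable_absLineIntegral (hm n 1 0))]
      rw [e]
      have i3 := mul_le_mul_of_nonneg_left (i 1 0 (by omega)) Real.pi_pos.le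
      linarith [i 0 0 (by omega), i 1 0 (by omega), i 0 1 (by omega)]
    refine squeeze_zero (fun n => integral_nonneg fun x => abs_nonneg _) hb ?_
    simpa using (tendsto_one_div_add_atTop_nhds_zero_nat (𝕜 := ℝ)).const_mul ((3 + Real.pi) * c)
  obtain ⟨ns, hns, hae⟩ := exists_subseq_ae_tendsto_zero hH hlim
  have hsq : ∀ {F : ℕ → ℝ × ℝ → ℝ} {G : ℝ × ℝ → ℝ},
      (∀ᵐ x ∂μΩ, ∀ n, |F n x - G x| ≤ H n x) →
      ∀ᵐ x ∂μΩ, Tendsto (fun i => F (ns i) x) atTop (𝓝 (G x)) := by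
    intro F G hFG
    filter_upwards [hFG, hae] with x hx hx'
    rw [tendsto_iff_norm_sub_tendsto_zero]
    exact squeeze_zero (fun i => norm_nonneg _) (fun i => hx (ns i)) hx'
  refine ⟨fun n => φ (ns n), fun n => hφ _, fun n a b hab => (hd (ns n) a b hab).trans ?_,
    hsq (F := φ) (.of_forall fun x n => ?_), hsq (F := fun n => pd1 (φ n)) (.of_forall fun x n => ?_),
    hsq (F := fun n => pd2 (φ n)) (.of_forall fun x n => ?_),
    hsq (F := fun n => vint (pd1 (φ n))) ?_⟩
  -- A strictly increasing sequence satisfies `n ≤ ns n`, so the rate survives the passage to the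
  -- subsequence.
  · have : (n : ℝ) ≤ ns n := by exact_mod_cast hns.id_le n
    exact one_div_le_one_div_of_le (by positivity) (by linarith)
  · have e : |φ n x - u x| = |(pd 0 0 (φ n) - wd 0 0 u) x| := by rw [wd_zero_zero]; rfl
    rw [e]
    have := absLineIntegral_nonneg (pd 1 0 (φ n) - wd 1 0 u) x
    simp only [H]
    linarith [abs_nonneg ((pd 1 0 (φ n) - wd 1 0 u) x), abs_nonneg ((pd 0 1 (φ n) - wd 0 1 u) x)]
  · change |(pd 1 0 (φ n) - wd 1 0 u) x| ≤ _
    have := absLineIntegral_nonneg (pd 1 0 (φ n) - wd 1 0 u) x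
    simp only [H]
    linarith [abs_nonneg ((pd 0 0 (φ n) - wd 0 0 u) x), abs_nonneg ((pd 0 1 (φ n) - wd 0 1 u) x)]
  · change |(pd 0 1 (φ n) - wd 0 1 u) x| ≤ _
    have := absLineIntegral_nonneg (pd 1 0 (φ n) - wd 1 0 u) x
    simp only [H]
    linarith [abs_nonneg ((pd 0 0 (φ n) - wd 0 0 u) x), abs_nonneg ((pd 1 0 (φ n) - wd 1 0 u) x)]
  · rw [ae_all_iff]
    intro n
    filter_upwards [ae_abs_vint_sub_le (continuous_pd1 (hφ n).contDiff)
      ((Lp.memLp (wd 1 0 u)).integrable (by norm_num))] with x hx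
    refine hx.trans ?_
    change absLineIntegral (pd 1 0 (φ n) - wd 1 0 u) x ≤ _
    simp only [H]
    linarith [abs_nonneg ((pd 0 0 (φ n) - wd 0 0 u) x), abs_nonneg ((pd 1 0 (φ n) - wd 1 0 u) x),
      abs_nonneg ((pd 0 1 (φ n) - wd 0 1 u) x)]

end HydroFlow

namespace HydroFlow

open Filter Topology

variable {f g h : ℝ × ℝ → ℝ} {u v w : L2} {k : ℕ} {φ γ η : ℕ → ℝ × ℝ → ℝ}

/-! ### Convergence of norms along an approximating sequence -/

lemma tendsto_inv_succ : Tendsto (fun n : ℕ => 1 / ((n : ℝ) + 1)) atTop (𝓝 0) :=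
  tendsto_one_div_add_atTop_nhds_zero_nat

lemma nrm_sub_le_add (hf : MemLp f 2 μΩ) (hg : MemLp g 2 μΩ) (hh : MemLp h 2 μΩ) :
    nrm (f - g) ≤ nrm (f - h) + nrm (g - h) := by
  rw [nrm_sub_comm g h]
  have := nrm_add_le (hf.sub hh) (hh.sub hg)
  rwa [sub_add_sub_cancel] at this

lemma abs_nrm_sub_le (hf : MemLp f 2 μΩ) (hg : MemLp g 2 μΩ) :
    |nrm f - nrm g| ≤ nrm (f - g) := by
  have h1 := nrm_add_le (hf.sub hg) hg
  have h2 := nrm_add_le (hg.sub hf) hf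
  rw [sub_add_cancel] at h1 h2
  rw [nrm_sub_comm g f] at h2
  exact abs_sub_le_iff.2 ⟨by linarith, by linarith⟩

lemma tendsto_nrm_of_le {F : ℕ → ℝ × ℝ → ℝ} {G : ℝ × ℝ → ℝ} (hF : ∀ n, MemLp (F n) 2 μΩ)
    (hG : MemLp G 2 μΩ) {C : ℝ} (hC : ∀ n : ℕ, nrm (F n - G) ≤ C * (1 / ((n : ℝ) + 1))) :
    Tendsto (fun n => nrm (F n)) atTop (𝓝 (nrm G)) := by
  rw [tendsto_iff_norm_sub_tendsto_zero]
  refine squeeze_zero (fun _ => norm_nonneg _)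
    (fun n => (abs_nrm_sub_le (hF n) hG).trans (hC n)) ?_
  simpa using tendsto_inv_succ.const_mul C

namespace Approximates

lemma contDiff (hφ : Approximates k u φ) (n : ℕ) : ContDiff ℝ ∞ (φ n) :=
  (hφ.smooth n).contDiff

lemma memLp_pd (hφ : Approximates k u φ) (n a b : ℕ) : MemLp (pd a b (φ n)) 2 μΩ :=
  memLp_of_continuous (contDiff_pd a b (hφ.contDiff n)).continuous 2

lemma tendsto_nrm_pd (hφ : Approximates k u φ) {a b : ℕ} (hab : a + b ≤ k) :
    Tendsto (fun n => nrm (pd a b (φ n))) atTop (𝓝 ‖wd a b u‖) := by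
  rw [norm_eq_nrm]
  exact tendsto_nrm_of_le (C := 1) (fun n => hφ.memLp_pd n a b) (Lp.memLp _)
    fun n => by simpa using hφ.nrm_sub_le n a b hab

lemma tendsto_nrm (hφ : Approximates k u φ) : Tendsto (fun n => nrm (φ n)) atTop (𝓝 ‖u‖) := by
  have h := hφ.tendsto_nrm_pd (a := 0) (b := 0) (Nat.zero_le _)
  rwa [wd_zero_zero] at h

lemma tendsto_smoothGrad (hφ : Approximates k u φ) (hk : 1 ≤ k) :
    Tendsto (fun n => smoothGrad (φ n)) atTop (𝓝 (gradNorm u)) :=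
  (((hφ.tendsto_nrm_pd (a := 1) (b := 0) hk).pow 2).add
    ((hφ.tendsto_nrm_pd (a := 0) (b := 1) hk).pow 2)).sqrt

lemma tendsto_smoothD1Grad (hφ : Approximates k u φ) (hk : 2 ≤ k) :
    Tendsto (fun n => smoothD1Grad (φ n)) atTop (𝓝 (d1GradNorm u)) :=
  (((hφ.tendsto_nrm_pd (a := 2) (b := 0) hk).pow 2).add
    ((hφ.tendsto_nrm_pd (a := 1) (b := 1) hk).pow 2)).sqrt

lemma tendsto_smoothLap (hφ : Approximates k u φ) (hk : 2 ≤ k) :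
    Tendsto (fun n => smoothLap (φ n)) atTop (𝓝 ‖lap u‖) := by
  have hl : nrm (lap u) = nrm ((wd 2 0 u : ℝ × ℝ → ℝ) + wd 0 2 u) :=
    nrm_congr_ae (Lp.coeFn_add _ _)
  rw [norm_eq_nrm, hl]
  refine tendsto_nrm_of_le (F := fun n => pd 2 0 (φ n) + pd 0 2 (φ n))
    (G := (wd 2 0 u : ℝ × ℝ → ℝ) + wd 0 2 u) (C := 2)
    (fun n => (hφ.memLp_pd n 2 0).add (hφ.memLp_pd n 0 2))
    ((Lp.memLp (wd 2 0 u)).add (Lp.memLp (wd 0 2 u))) fun n => ?_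
  have h := nrm_add_le (memLp_pd_sub (hφ.smooth n) 2 0 (wd 2 0 u))
    (memLp_pd_sub (hφ.smooth n) 0 2 (wd 0 2 u))
  rw [sub_add_sub_comm] at h
  linarith [hφ.nrm_sub_le n 2 0 hk, hφ.nrm_sub_le n 0 2 hk]

lemma nrm_pd_sub_le (hφ : Approximates k u φ) {a b : ℕ} (hab : a + b ≤ k) (m n : ℕ) :
    nrm (pd a b (φ m - φ n)) ≤ 1 / ((m : ℝ) + 1) + 1 / ((n : ℝ) + 1) := by
  rw [pd_sub a b (hφ.contDiff m) (hφ.contDiff n)]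
  exact (nrm_sub_le_add (hφ.memLp_pd m a b) (hφ.memLp_pd n a b) (Lp.memLp (wd a b u))).trans
    (add_le_add (hφ.nrm_sub_le m a b hab) (hφ.nrm_sub_le n a b hab))

lemma smoothGrad_sub_le (hφ : Approximates k u φ) (hk : 1 ≤ k) (m n : ℕ) :
    smoothGrad (φ m - φ n) ≤ 2 * (1 / ((m : ℝ) + 1) + 1 / ((n : ℝ) + 1)) := by
  have h1 : nrm (pd1 (φ m - φ n)) ≤ _ := hφ.nrm_pd_sub_le (a := 1) (b := 0) hk m n
  have h2 : nrm (pd2 (φ m - φ n)) ≤ _ := hφ.nrm_pd_sub_le (a := 0) (b := 1) hk m n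
  have n1 := nrm_nonneg (pd1 (φ m - φ n))
  have n2 := nrm_nonneg (pd2 (φ m - φ n))
  refine Real.sqrt_le_iff.2 ⟨by positivity, ?_⟩
  nlinarith

lemma smoothLap_sub_le (hφ : Approximates k u φ) (hk : 2 ≤ k) (m n : ℕ) :
    smoothLap (φ m - φ n) ≤ 2 * (1 / ((m : ℝ) + 1) + 1 / ((n : ℝ) + 1)) := by
  have h1 := hφ.nrm_pd_sub_le (a := 2) (b := 0) hk m n
  have h2 := hφ.nrm_pd_sub_le (a := 0) (b := 2) hk m n
  have hs := ((hφ.smooth m).sub (hφ.smooth n)).contDiff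
  have h3 : smoothLap (φ m - φ n) ≤ nrm (pd 2 0 (φ m - φ n)) + nrm (pd 0 2 (φ m - φ n)) :=
    nrm_add_le (memLp_of_continuous (contDiff_pd 2 0 hs).continuous 2)
      (memLp_of_continuous (contDiff_pd 0 2 hs).continuous 2)
  linarith

lemma exists_smoothGrad_le (hφ : Approximates k u φ) (hk : 1 ≤ k) :
    ∃ K, ∀ n, smoothGrad (φ n) ≤ K := by
  obtain ⟨K, hK⟩ := (hφ.tendsto_smoothGrad hk).bddAbove_range
  exact ⟨K, fun n => hK ⟨n, rfl⟩⟩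

lemma exists_smoothLap_le (hφ : Approximates k u φ) (hk : 2 ≤ k) :
    ∃ K, ∀ n, smoothLap (φ n) ≤ K := by
  obtain ⟨K, hK⟩ := (hφ.tendsto_smoothLap hk).bddAbove_range
  exact ⟨K, fun n => hK ⟨n, rfl⟩⟩

lemma ae_tendsto_smoothB (hφ : Approximates k u φ) (hγ : Approximates k v γ) :
    ∀ᵐ x ∂μΩ, Tendsto (fun n => smoothB (φ n) (γ n) x) atTop (𝓝 (B u v x)) := by
  filter_upwards [hφ.ae_tendsto, hφ.ae_tendsto_vint, hγ.ae_tendsto_pd1, hγ.ae_tendsto_pd2]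
    with x h0 h1 h2 h3
  exact (h0.mul h2).add (h1.mul h3)

end Approximates

/-! ### Poincaré-type inequalities on the closures -/

lemma norm_le_gradNorm (hk : 1 ≤ k) (hu : u ∈ HDiv k) : ‖u‖ ≤ gradNorm u := by
  obtain ⟨φ, hφ⟩ := exists_approximates hk hu
  exact le_of_tendsto_of_tendsto' hφ.tendsto_nrm (hφ.tendsto_smoothGrad hk)
    fun n => (hφ.smooth n).nrm_le_smoothGrad

lemma gradNorm_le_norm_lap (hu : u ∈ HDiv 2) : gradNorm u ≤ ‖lap u‖ := by
  obtain ⟨φ, hφ⟩ := exists_approximates one_le_two hu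
  exact le_of_tendsto_of_tendsto' (hφ.tendsto_smoothGrad one_le_two) (hφ.tendsto_smoothLap le_rfl)
    fun n => (hφ.smooth n).smoothGrad_le_smoothLap

lemma d1GradNorm_le_norm_lap (hu : u ∈ HDiv 2) : d1GradNorm u ≤ ‖lap u‖ := by
  obtain ⟨φ, hφ⟩ := exists_approximates one_le_two hu
  exact le_of_tendsto_of_tendsto' (hφ.tendsto_smoothD1Grad le_rfl) (hφ.tendsto_smoothLap le_rfl)
    fun n => (hφ.smooth n).smoothD1Grad_le_smoothLap

/-! ### Strong convergence of the nonlinearity -/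

/-- An almost everywhere convergent sequence of continuous functions which is Cauchy in `L_p(Ω)`
with the given rate converges in `L_p(Ω)`. -/
lemma memLp_and_eLpNorm_sub_le_of_cauchy {p : ENNReal} {F : ℕ → ℝ × ℝ → ℝ}
    {G : ℝ × ℝ → ℝ} (hF : ∀ n, Continuous (F n))
    (hlim : ∀ᵐ x ∂μΩ, Tendsto (fun n => F n x) atTop (𝓝 (G x))) {C : ℝ}
    (hC : ∀ m n : ℕ, (eLpNorm (F m - F n) p μΩ).toReal ≤
      C * (1 / ((m : ℝ) + 1) + 1 / ((n : ℝ) + 1))) :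
    MemLp G p μΩ ∧ ∀ n : ℕ, (eLpNorm (G - F n) p μΩ).toReal ≤ C * (1 / ((n : ℝ) + 1)) := by
  have hm : ∀ n, MemLp (F n) p μΩ := fun n => memLp_of_continuous (hF n) p
  have hC0 : 0 ≤ C := by
    have := (ENNReal.toReal_nonneg).trans (hC 0 0)
    norm_num at this
    linarith
  have hle : ∀ n : ℕ, eLpNorm (G - F n) p μΩ ≤ ENNReal.ofReal (C * (1 / ((n : ℝ) + 1))) := by
    intro n
    -- Fatou's lemma in `m`, with `n` fixed.
    have h1 := Lp.eLpNorm_lim_le_liminf_eLpNorm (p := p) (f := fun m => F m - F n)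
      (fun m => ((hm m).sub (hm n)).1) (G - F n) (by
        filter_upwards [hlim] with x hx
        exact hx.sub_const _)
    refine h1.trans ?_
    have ht : Tendsto (fun m : ℕ => ENNReal.ofReal (C * (1 / ((m : ℝ) + 1) + 1 / ((n : ℝ) + 1))))
        atTop (𝓝 (ENNReal.ofReal (C * (1 / ((n : ℝ) + 1))))) := by
      refine (ENNReal.continuous_ofReal.tendsto _).comp ?_
      simpa using (tendsto_inv_succ.add_const (1 / ((n : ℝ) + 1))).const_mul C
    rw [← ht.liminf_eq]
    refine liminf_le_liminf (.of_forall fun m => ?_)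
    exact (ENNReal.le_ofReal_iff_toReal_le ((hm m).sub (hm n)).eLpNorm_ne_top (by positivity)).2
      (hC m n)
  have hGm : AEStronglyMeasurable G μΩ := aestronglyMeasurable_of_tendsto_ae atTop
    (fun n => (hm n).1) hlim
  refine ⟨?_, fun n => ENNReal.toReal_le_of_le_ofReal (by positivity) (hle n)⟩
  have h0 : MemLp (G - F 0) p μΩ :=
    ⟨hGm.sub (hm 0).1, (hle 0).trans_lt ENNReal.ofReal_lt_top⟩
  simpa using h0.add (hm 0)

lemma toReal_eLpNorm_one (hf : AEStronglyMeasurable f μΩ) :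
    (eLpNorm f 1 μΩ).toReal = ∫ x, |f x| ∂μΩ := by
  rw [eLpNorm_one_eq_lintegral_enorm, ← integral_norm_eq_lintegral_enorm hf]
  rfl

namespace Approximates

/-- Bilinearity splits the difference of two terms into one with `φ m - φ n` and one with `γ m - γ
n`. The estimate with constant `9` and the bound `2δ` on the differences give the factor `18`. -/
lemma memLp_B (hφ : Approximates 2 u φ) (hγ : Approximates 2 v γ) :
    ∃ C, MemLp (B u v) 2 μΩ ∧
      ∀ n : ℕ, nrm (B u v - smoothB (φ n) (γ n)) ≤ C * (1 / ((n : ℝ) + 1)) := by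
  obtain ⟨K, hK⟩ := hφ.exists_smoothGrad_le one_le_two
  obtain ⟨L, hL⟩ := hγ.exists_smoothLap_le le_rfl
  have hK0 : 0 ≤ K := (smoothGrad_nonneg _).trans (hK 0)
  refine ⟨18 * (K + L), memLp_and_eLpNorm_sub_le_of_cauchy
    (fun n => continuous_smoothB (hφ.contDiff n) (hγ.contDiff n)) (hφ.ae_tendsto_smoothB hγ)
    fun m n => ?_⟩
  change nrm _ ≤ _
  have e : smoothB (φ m) (γ m) - smoothB (φ n) (γ n) =
      smoothB (φ m - φ n) (γ m) + smoothB (φ n) (γ m - γ n) := by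
    rw [smoothB_sub_left (hφ.contDiff m) (hφ.contDiff n),
      smoothB_sub_right _ (hγ.contDiff m) (hγ.contDiff n), sub_add_sub_cancel]
  have sφ := (hφ.smooth m).sub (hφ.smooth n)
  have sγ := (hγ.smooth m).sub (hγ.smooth n)
  rw [e]
  refine (nrm_add_le
    (memLp_of_continuous (continuous_smoothB sφ.contDiff (hγ.contDiff m)) 2)
    (memLp_of_continuous (continuous_smoothB (hφ.contDiff n) sγ.contDiff) 2)).trans ?_
  refine (add_le_add (nrm_smoothB_le_smoothLap sφ (hγ.smooth m))
    (nrm_smoothB_le_smoothLap (hφ.smooth n) sγ)).trans ?_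
  set δ := 1 / ((m : ℝ) + 1) + 1 / ((n : ℝ) + 1) with hδ
  have hδ0 : 0 ≤ δ := by positivity
  have l0 : 0 ≤ smoothLap (γ m) := nrm_nonneg _
  have l1 : 0 ≤ smoothLap (γ m - γ n) := nrm_nonneg _
  calc 9 * smoothGrad (φ m - φ n) * smoothLap (γ m) + 9 * smoothGrad (φ n) * smoothLap (γ m - γ n)
      ≤ 9 * (2 * δ) * L + 9 * K * (2 * δ) := by
        gcongr
        · exact hφ.smoothGrad_sub_le one_le_two m n
        · exact hL m
        · exact hK n
        · exact hγ.smoothLap_sub_le le_rfl m n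
    _ = 18 * (K + L) * δ := by ring

/-- The trilinear analogue in `L₁`: three differences, each with factor `7 · 2 = 14`. Only gradient
norms enter, so `H¹` approximation suffices. -/
lemma integrable_B_mul (hφ : Approximates k u φ) (hγ : Approximates k v γ)
    (hη : Approximates k w η) (hk : 1 ≤ k) :
    ∃ C, Integrable (fun x => B u v x * w x) μΩ ∧
      ∀ n : ℕ, ∫ x, |B u v x * w x - smoothB (φ n) (γ n) x * η n x| ∂μΩ ≤
        C * (1 / ((n : ℝ) + 1)) := by
  obtain ⟨K₁, hK₁⟩ := hφ.exists_smoothGrad_le hk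
  obtain ⟨K₂, hK₂⟩ := hγ.exists_smoothGrad_le hk
  obtain ⟨K₃, hK₃⟩ := hη.exists_smoothGrad_le hk
  have p₁ : 0 ≤ K₁ := (smoothGrad_nonneg _).trans (hK₁ 0)
  have p₂ : 0 ≤ K₂ := (smoothGrad_nonneg _).trans (hK₂ 0)
  have p₃ : 0 ≤ K₃ := (smoothGrad_nonneg _).trans (hK₃ 0)
  have hcB : ∀ {φ γ η : ℝ × ℝ → ℝ}, IsSmoothDiv φ → IsSmoothDiv γ → IsSmoothDiv η →
      Continuous fun x => smoothB φ γ x * η x := fun hφ hγ hη =>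
    (continuous_smoothB hφ.contDiff hγ.contDiff).mul hη.contDiff.continuous
  have hc := fun n => hcB (hφ.smooth n) (hγ.smooth n) (hη.smooth n)
  have hlim : ∀ᵐ x ∂μΩ, Tendsto (fun n => smoothB (φ n) (γ n) x * η n x) atTop
      (𝓝 (B u v x * w x)) := by
    filter_upwards [hφ.ae_tendsto_smoothB hγ, hη.ae_tendsto] with x h1 h2 using h1.mul h2
  have key := memLp_and_eLpNorm_sub_le_of_cauchy (p := 1) hc hlim
    (C := 14 * (K₂ * K₃ + K₁ * K₃ + K₁ * K₂)) fun m n => by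
    have sφ := (hφ.smooth m).sub (hφ.smooth n)
    have sγ := (hγ.smooth m).sub (hγ.smooth n)
    have sη := (hη.smooth m).sub (hη.smooth n)
    rw [toReal_eLpNorm_one ((hc m).sub (hc n)).aestronglyMeasurable]
    have c1 := hcB sφ (hγ.smooth m) (hη.smooth m)
    have c2 := hcB (hφ.smooth n) sγ (hη.smooth m)
    have c3 := hcB (hφ.smooth n) (hγ.smooth n) sη
    have i1 := (integrable_of_continuous c1).abs
    have i2 := (integrable_of_continuous c2).abs
    have i3 := (integrable_of_continuous c3).abs
    have hle : ∫ x, |((fun x => smoothB (φ m) (γ m) x * η m x) -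
          fun x => smoothB (φ n) (γ n) x * η n x) x| ∂μΩ ≤
        ∫ x, |smoothB (φ m - φ n) (γ m) x * η m x| ∂μΩ +
        ∫ x, |smoothB (φ n) (γ m - γ n) x * η m x| ∂μΩ +
        ∫ x, |smoothB (φ n) (γ n) x * (η m - η n) x| ∂μΩ := by
      rw [← integral_add i1 i2, ← integral_add (i1.add i2 : Integrable (fun x => _ + _) μΩ) i3]
      refine integral_mono (integrable_of_continuous ((hc m).sub (hc n))).abs
        ((i1.add i2).add i3) fun x => ?_
      refine le_trans (le_of_eq ?_) (abs_add_three _ _ _)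
      rw [smoothB_sub_left (hφ.contDiff m) (hφ.contDiff n),
        smoothB_sub_right _ (hγ.contDiff m) (hγ.contDiff n)]
      simp only [Pi.sub_apply]
      congr 1
      ring
    refine hle.trans ((add_le_add (add_le_add
      (integral_abs_smoothB_mul_le sφ (hγ.smooth m) (hη.smooth m))
      (integral_abs_smoothB_mul_le (hφ.smooth n) sγ (hη.smooth m)))
      (integral_abs_smoothB_mul_le (hφ.smooth n) (hγ.smooth n) sη)).trans ?_)
    have d1 := hφ.smoothGrad_sub_le hk m n
    have d2 := hγ.smoothGrad_sub_le hk m n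
    have d3 := hη.smoothGrad_sub_le hk m n
    set δ := 1 / ((m : ℝ) + 1) + 1 / ((n : ℝ) + 1) with hδ
    have hδ0 : 0 ≤ δ := by positivity
    have q := smoothGrad_nonneg
    calc _ ≤ 7 * (2 * δ) * K₂ * K₃ + 7 * K₁ * (2 * δ) * K₃ + 7 * K₁ * K₂ * (2 * δ) := by
          have b1 := hK₁ n
          have b2 := hK₂ m
          have b2' := hK₂ n
          have b3 := hK₃ m
          have q1 := q (φ n)
          have q2 := q (γ m)
          have q2' := q (γ n)
          have q3 := q (η m)
          have q4 := q (φ m - φ n)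
          have q5 := q (γ m - γ n)
          have q6 := q (η m - η n)
          gcongr
      _ = 14 * (K₂ * K₃ + K₁ * K₃ + K₁ * K₂) * δ := by ring
  refine ⟨14 * (K₂ * K₃ + K₁ * K₃ + K₁ * K₂), memLp_one_iff_integrable.1 key.1, fun n => ?_⟩
  have h := key.2 n
  rwa [toReal_eLpNorm_one (key.1.1.sub (hc n).aestronglyMeasurable)] at h

end Approximates

end HydroFlow

namespace HydroFlow

open Filter Topology

variable {u v w : L2} {k : ℕ}

/-! ### The estimates and cancellation properties on the closures -/

theorem integrable_B_mul_and_integral_le (hk : 1 ≤ k) (hu : u ∈ HDiv k) (hv : v ∈ HDiv k)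
    (hw : w ∈ HDiv k) :
    Integrable (fun x => B u v x * w x) μΩ ∧
      ∫ x, |B u v x * w x| ∂μΩ ≤ 7 * gradNorm u * gradNorm v * gradNorm w := by
  obtain ⟨φ, hφ⟩ := exists_approximates hk hu
  obtain ⟨γ, hγ⟩ := exists_approximates hk hv
  obtain ⟨η, hη⟩ := exists_approximates hk hw
  obtain ⟨C, hi, hC⟩ := hφ.integrable_B_mul hγ hη hk
  refine ⟨hi, ?_⟩
  have ht := (tendsto_inv_succ.const_mul C).add
    ((((hφ.tendsto_smoothGrad hk).const_mul 7).mul (hγ.tendsto_smoothGrad hk)).mul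
      (hη.tendsto_smoothGrad hk))
  rw [mul_zero, zero_add] at ht
  refine ge_of_tendsto' ht fun n => ?_
  have hn : Integrable (fun x => smoothB (φ n) (γ n) x * η n x) μΩ := integrable_of_continuous
    ((continuous_smoothB (hφ.contDiff n) (hγ.contDiff n)).mul (hη.contDiff n).continuous)
  refine le_trans ?_ (add_le_add (hC n)
    (integral_abs_smoothB_mul_le (hφ.smooth n) (hγ.smooth n) (hη.smooth n)))
  have hs : Integrable (fun x => |B u v x * w x - smoothB (φ n) (γ n) x * η n x|) μΩ :=
    (hi.sub hn).abs
  rw [← integral_add hs hn.abs]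
  refine integral_mono hi.abs (hs.add hn.abs) fun x => ?_
  simpa using abs_add_le (B u v x * w x - smoothB (φ n) (γ n) x * η n x)
    (smoothB (φ n) (γ n) x * η n x)

theorem integral_B_mul_self (hk : 1 ≤ k) (hu : u ∈ HDiv k) (hv : v ∈ HDiv k) :
    ∫ x, B u v x * v x ∂μΩ = 0 := by
  obtain ⟨φ, hφ⟩ := exists_approximates hk hu
  obtain ⟨γ, hγ⟩ := exists_approximates hk hv
  obtain ⟨C, hi, hC⟩ := hφ.integrable_B_mul hγ hγ hk
  have ht := tendsto_inv_succ.const_mul C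
  rw [mul_zero] at ht
  refine abs_nonpos_iff.1 (ge_of_tendsto' ht fun n => ?_)
  have hn : Integrable (fun x => smoothB (φ n) (γ n) x * γ n x) μΩ := integrable_of_continuous
    ((continuous_smoothB (hφ.contDiff n) (hγ.contDiff n)).mul (hγ.contDiff n).continuous)
  rw [← sub_zero (∫ x, B u v x * v x ∂μΩ),
    ← integral_smoothB_mul_self (hφ.smooth n) (hγ.smooth n), ← integral_sub hi hn]
  exact abs_integral_le_integral_abs.trans (hC n)

theorem memLp_B_and_nrm_le (hu : u ∈ HDiv 2) (hv : v ∈ HDiv 2) :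
    MemLp (B u v) 2 μΩ ∧
      nrm (B u v) ≤ 3 * (√‖u‖ * √(gradNorm u) * √‖wd 1 0 v‖ * √(d1GradNorm v) +
        ‖wd 1 0 u‖ * √‖wd 0 1 v‖ * (√‖wd 0 1 v‖ + √(d1GradNorm v))) := by
  obtain ⟨φ, hφ⟩ := exists_approximates one_le_two hu
  obtain ⟨γ, hγ⟩ := exists_approximates one_le_two hv
  obtain ⟨C, hm, hC⟩ := hφ.memLp_B hγ
  refine ⟨hm, ?_⟩
  have t1 : Tendsto (fun n => nrm (pd1 (φ n))) atTop (𝓝 ‖wd 1 0 u‖) :=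
    hφ.tendsto_nrm_pd (a := 1) (b := 0) one_le_two
  have t2 : Tendsto (fun n => nrm (pd1 (γ n))) atTop (𝓝 ‖wd 1 0 v‖) :=
    hγ.tendsto_nrm_pd (a := 1) (b := 0) one_le_two
  have t3 : Tendsto (fun n => nrm (pd2 (γ n))) atTop (𝓝 ‖wd 0 1 v‖) :=
    hγ.tendsto_nrm_pd (a := 0) (b := 1) one_le_two
  have t4 := (hγ.tendsto_smoothD1Grad le_rfl).sqrt
  have ht := (tendsto_inv_succ.const_mul C).add
    (((((hφ.tendsto_nrm.sqrt.mul (hφ.tendsto_smoothGrad one_le_two).sqrt).mul t2.sqrt).mul t4).add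
      ((t1.mul t3.sqrt).mul (t3.sqrt.add t4))).const_mul 3)
  rw [mul_zero, zero_add] at ht
  refine ge_of_tendsto' ht fun n => ?_
  have hn : MemLp (smoothB (φ n) (γ n)) 2 μΩ :=
    memLp_of_continuous (continuous_smoothB (hφ.contDiff n) (hγ.contDiff n)) 2
  have h := nrm_add_le (hm.sub hn) hn
  rw [sub_add_cancel] at h
  exact h.trans (add_le_add (hC n) (nrm_smoothB_le (hφ.smooth n) (hγ.smooth n)))

theorem integral_B_mul_wd_zero_two (hu : u ∈ HDiv 2) :
    ∫ x, B u u x * wd 0 2 u x ∂μΩ = 0 := by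
  obtain ⟨φ, hφ⟩ := exists_approximates one_le_two hu
  obtain ⟨C, hm, hC⟩ := hφ.memLp_B hφ
  have hw : MemLp (wd 0 2 u) 2 μΩ := Lp.memLp _
  have ht := ((tendsto_inv_succ.const_mul C).mul
    (hφ.tendsto_nrm_pd (a := 0) (b := 2) le_rfl)).add (tendsto_inv_succ.const_mul (nrm (B u u)))
  rw [mul_zero, zero_mul, mul_zero, add_zero] at ht
  refine abs_nonpos_iff.1 (ge_of_tendsto' ht fun n => ?_)
  have hn : MemLp (smoothB (φ n) (φ n)) 2 μΩ :=
    memLp_of_continuous (continuous_smoothB (hφ.contDiff n) (hφ.contDiff n)) 2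
  have hd := hφ.memLp_pd n 0 2
  have i1 := integrable_mul_of_memLp (hm.sub hn) hd
  have i2 := integrable_mul_of_memLp hm (hd.sub hw)
  -- Inserting the smooth identity, which is zero, leaves two errors: one from `B(φ n, φ n)`, paired
  -- with the bounded `∂₂²φ n`, and one from `∂₂²φ n`, paired with the fixed `B u u`.
  have e : ∫ x, B u u x * wd 0 2 u x ∂μΩ =
      ∫ x, (B u u - smoothB (φ n) (φ n)) x * pd 0 2 (φ n) x ∂μΩ -
        ∫ x, B u u x * (pd 0 2 (φ n) - wd 0 2 u) x ∂μΩ := by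
    have hz : ∫ x, smoothB (φ n) (φ n) x * pd 0 2 (φ n) x ∂μΩ = 0 :=
      integral_smoothB_mul_pd2_pd2 (hφ.smooth n)
    rw [← integral_sub i1 i2, ← add_zero (∫ x, ((B u u - smoothB (φ n) (φ n)) x *
      pd 0 2 (φ n) x - B u u x * (pd 0 2 (φ n) - wd 0 2 u) x) ∂μΩ), ← hz,
      ← integral_add (i1.sub i2 : Integrable (fun x => _ - _) μΩ) (integrable_mul_of_memLp hn hd)]
    refine integral_congr_ae (.of_forall fun x => ?_)
    simp only [Pi.sub_apply]
    ring
  rw [e]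
  refine (abs_sub _ _).trans (add_le_add ?_ ?_)
  · refine abs_integral_le_integral_abs.trans ((integral_abs_mul_le (hm.sub hn) hd).trans ?_)
    exact mul_le_mul_of_nonneg_right (hC n) (nrm_nonneg _)
  · refine abs_integral_le_integral_abs.trans ((integral_abs_mul_le hm (hd.sub hw)).trans ?_)
    exact mul_le_mul_of_nonneg_left (hφ.nrm_sub_le n 0 2 le_rfl) (nrm_nonneg _)

end HydroFlow

theorem lemma3p1 :
    -- part (a)
    (∃ M : ℝ, 0 ≤ M ∧
      ∀ u ∈ HydroFlow.HDiv 1, ∀ v ∈ HydroFlow.HDiv 1, ∀ w ∈ HydroFlow.HDiv 1,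
        Integrable (fun x => HydroFlow.B u v x * w x) HydroFlow.μΩ ∧
        ∫ x, |HydroFlow.B u v x * w x| ∂HydroFlow.μΩ ≤
          M * HydroFlow.gradNorm u * HydroFlow.gradNorm v * HydroFlow.gradNorm w) ∧
    -- part (b)
    (∃ M' M'' : ℝ, 0 ≤ M' ∧ 0 ≤ M'' ∧
      ∀ u ∈ HydroFlow.HDiv 2, ∀ v ∈ HydroFlow.HDiv 2, ∀ w : HydroFlow.L2,
        Integrable (fun x => HydroFlow.B u v x * w x) HydroFlow.μΩ ∧
        ∫ x, |HydroFlow.B u v x * w x| ∂HydroFlow.μΩ ≤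
          M' * (√‖u‖ * √(HydroFlow.gradNorm u) *
                √‖HydroFlow.wd 1 0 v‖ * √(HydroFlow.d1GradNorm v) +
              ‖HydroFlow.wd 1 0 u‖ * √‖HydroFlow.wd 0 1 v‖ *
                (√‖HydroFlow.wd 0 1 v‖ + √(HydroFlow.d1GradNorm v))) * ‖w‖ ∧
        M' * (√‖u‖ * √(HydroFlow.gradNorm u) *
                √‖HydroFlow.wd 1 0 v‖ * √(HydroFlow.d1GradNorm v) +
              ‖HydroFlow.wd 1 0 u‖ * √‖HydroFlow.wd 0 1 v‖ *
                (√‖HydroFlow.wd 0 1 v‖ + √(HydroFlow.d1GradNorm v))) * ‖w‖ ≤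
          M'' * HydroFlow.gradNorm u * √(HydroFlow.gradNorm v) * √‖HydroFlow.lap v‖ * ‖w‖ ∧
        M'' * HydroFlow.gradNorm u * √(HydroFlow.gradNorm v) * √‖HydroFlow.lap v‖ * ‖w‖ ≤
          M'' * HydroFlow.gradNorm u * ‖HydroFlow.lap v‖ * ‖w‖) ∧
    -- part (c)
    (∀ u ∈ HydroFlow.HDiv 1, ∀ v ∈ HydroFlow.HDiv 1,
      Integrable (fun x => HydroFlow.B u v x * v x) HydroFlow.μΩ ∧
      ∫ x, HydroFlow.B u v x * v x ∂HydroFlow.μΩ = 0) ∧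
    (∀ u ∈ HydroFlow.HDiv 2,
      MemLp (HydroFlow.B u u) 2 HydroFlow.μΩ ∧
      ∫ x, HydroFlow.B u u x * HydroFlow.wd 0 2 u x ∂HydroFlow.μΩ = 0) := by
  refine ⟨⟨7, by norm_num, fun u hu v hv w hw =>
    HydroFlow.integrable_B_mul_and_integral_le le_rfl hu hv hw⟩,
    ⟨3, 9, by norm_num, by norm_num, fun u hu v hv w => ?_⟩,
    fun u hu v hv => ⟨(HydroFlow.integrable_B_mul_and_integral_le le_rfl hu hv hv).1,
      HydroFlow.integral_B_mul_self le_rfl hu hv⟩,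
    fun u hu => ⟨(HydroFlow.memLp_B_and_nrm_le hu hu).1, HydroFlow.integral_B_mul_wd_zero_two hu⟩⟩
  -- Here `w` is merely in `L₂`, so the argument goes through `B u v` in `L₂` and Cauchy–Schwarz.
  obtain ⟨hm, hb⟩ := HydroFlow.memLp_B_and_nrm_le hu hv
  have hw : MemLp w 2 HydroFlow.μΩ := Lp.memLp w
  have hG : 0 ≤ HydroFlow.gradNorm u := Real.sqrt_nonneg _
  refine ⟨HydroFlow.integrable_mul_of_memLp hm hw, ?_, ?_, ?_⟩
  · refine (HydroFlow.integral_abs_mul_le hm hw).trans ?_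
    rw [HydroFlow.norm_eq_nrm w]
    exact mul_le_mul_of_nonneg_right hb (HydroFlow.nrm_nonneg _)
  · refine mul_le_mul_of_nonneg_right ?_ (norm_nonneg w)
    exact HydroFlow.nonlinearity_bound_le (norm_nonneg u)
      (HydroFlow.norm_le_gradNorm one_le_two hu)
      (Real.le_sqrt_of_sq_le (by linarith [sq_nonneg ‖HydroFlow.wd 0 1 u‖]))
      (Real.le_sqrt_of_sq_le (by linarith [sq_nonneg ‖HydroFlow.wd 0 1 v‖]))
      (Real.le_sqrt_of_sq_le (by linarith [sq_nonneg ‖HydroFlow.wd 1 0 v‖]))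
      (HydroFlow.d1GradNorm_le_norm_lap hv) (HydroFlow.gradNorm_le_norm_lap hv)
  · refine mul_le_mul_of_nonneg_right ?_ (norm_nonneg w)
    rw [mul_assoc (9 * HydroFlow.gradNorm u)]
    refine mul_le_mul_of_nonneg_left ?_ (by positivity)
    calc √(HydroFlow.gradNorm v) * √‖HydroFlow.lap v‖
        ≤ √‖HydroFlow.lap v‖ * √‖HydroFlow.lap v‖ := by
          gcongr
          exact HydroFlow.gradNorm_le_norm_lap hv
      _ = ‖HydroFlow.lap v‖ := Real.mul_self_sqrt (norm_nonneg _)
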